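/- Identify $\mathbb{CP}^3$ with the projectivization of the space of complex $2\times 2$ matrices, let $Q=\{\det=0\}\subset\mathbb{CP}^3$, and regard $PSL_2(\mathbb C)=PGL_2(\mathbb C)=\mathbb{CP}^3\setminus Q$ and $PSU(2)\subset PSL_2(\mathbb C)$ (classes of unitary matrices). The spherical coamoeba map $\varkappa^\circ: PSL_2(\mathbb C)\to PSU(2)$ sends $[PU]$ to $[U]$, where $PU$ is the polar decomposition ($P$ positive definite, $U$ unitary). For $h\ge 0$ let $R_h:\mathbb{CP}^3\to\mathbb{CP}^3$ be $R_h[PU]=[P^hU]$ on $PSL_2(\mathbb C)$ and the identity on $Q$. Let $\mathcal S=\{[B]_{\mathbb R^*} : B\ne 0,\ \det B=0\}$ be the set of nonzero singular complex $2\times2$ matrices modulo nonzero real scalars, a circle bundle over $Q$ through $[B]_{\mathbb R^*}\mapsto[B]_{\mathbb C^*}$. Use the cone picture $$\mathbb{CP}^3=\{0\}\times PSU(2)\ \sqcup\ (0,\infty)\times\mathcal S\ \sqcup\ \{\infty\}\times Q,$$ where $\{0\}\times PSU(2)$ and $\{\infty\}\times Q$ are included in the obvious way and $(\alpha,[B]_{\mathbb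 R^*})$ is the point $[e^{\alpha}B+e^{-\alpha}(B^c)^*]_{\mathbb C^*}$, with $B^c$ the adjugate of $B$ and $*$ the conjugate transpose. Let $\mathbb K$ be the field of Hahn series with real exponents and complex coefficients in a variable $t\to\infty$. For $A=Bt^\alpha+o(t^\alpha)$ a nonzero $2\times 2$ matrix over $\mathbb K$ with leading coefficient $B\neq 0$, let $$\operatorname{VAL}([A]_{\mathbb K^*})=\lim_{t\to\infty}R_{1/\log t}[A(t)]_{\mathbb C^*}\in\mathbb{CP}^3$$ if the entries of $A$ converge for large $t$; in general $\operatorname{VAL}([A]_{\mathbb K^*})$ is the same limit for any matrix with convergent entries that has the same determinant and the same top order term $Bt^\alpha$ as $A$ (the limit depends only on these). Let $V$ be a (Zariski closed, possibly reducible) subvariety of $\mathbb{CP}^3$ with no irreducible component contained in $Q$, and let $V(\mathbb K)\subset\mathbb{KP}^3$ be its set of $\mathbb K$-points. Then $\operatorname{VAL}$ is well defined at every point of $V(\mathbb K)$, and $$\operatorname{VAL}(V(\mathbb K))=\{0\}\times\varkappa^\circ(V\cap PSL_2(\mathbb C))\ \cup\ (0,\infty)\times\mathcal S|_{V\cap Q}\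 \cup\ \{\infty\}\times(V\cap Q),$$ where $\mathcal S|_{V\cap Q}$ is the total space of the circle bundle $\mathcal S$ restricted to $V\cap Q$. -/

import Mathlib

open Filter Topology
open scoped Matrix

/-- The space of `2 × 2` matrices over `L`. -/
abbrev Mat (L : Type*) : Type _ := Matrix (Fin 2) (Fin 2) L

/-- Projective three-space over `L`, as the projectivization of the space of `2 × 2` matrices.
For `L = ℂ` this is the compactification of `PSL₂(ℂ) = PGL₂(ℂ)`. -/
abbrev P3 (L : Type*) [Field L] : Type _ := Projectivization L (Mat L)

/-- The Euclidean topology on `ℂP³`: the quotient topology from the nonzero matrices. -/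
noncomputable instance : TopologicalSpace (P3 ℂ) :=
  TopologicalSpace.coinduced
    (fun A : {A : Mat ℂ // A ≠ 0} => Projectivization.mk ℂ A.1 A.2) inferInstance

/-- The quadric `Q` of (classes of) matrices with zero determinant. -/
def quadric : Set (P3 ℂ) := {x | ∃ (A : Mat ℂ) (hA : A ≠ 0), A.det = 0 ∧
  x = Projectivization.mk ℂ A hA}

lemma mk_mem_quadric {A : Mat ℂ} {hA : A ≠ 0} :
    Projectivization.mk ℂ A hA ∈ quadric ↔ A.det = 0 := by
  constructor
  · rintro ⟨B, hB, hd, he⟩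
    rw [Projectivization.mk_eq_mk_iff'] at he
    obtain ⟨a, rfl⟩ := he
    simp [hd]
  · intro h
    exact ⟨A, hA, h, rfl⟩

/-- `PSL₂(ℂ)` as the complement of `Q` in `ℂP³`. -/
abbrev PSL2 : Type := {x : P3 ℂ // x ∉ quadric}

/-- `PSU(2)` as the set of classes of unitary matrices in `ℂP³`. -/
def PSU2 : Set (P3 ℂ) := {x | ∃ (U : Mat ℂ) (hU : U ≠ 0), U ∈ Matrix.unitaryGroup (Fin 2) ℂ ∧
  x = Projectivization.mk ℂ U hU}

/-! ### Polar decomposition, the maps `R_h` and the spherical coamoeba -/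

/-- The positive semidefinite factor `P = √(A A*)` of the polar decomposition `A = P U`. -/
noncomputable def polarP (A : Mat ℂ) : Mat ℂ := cfc (fun x : ℝ => √x) (A * Aᴴ)

/-- The unitary factor `U = P⁻¹ A` of the polar decomposition `A = P U` of an invertible `A`. -/
noncomputable def polarU (A : Mat ℂ) : Mat ℂ := (polarP A)⁻¹ * A

/-- The power `P ^ h` of the positive definite factor of the polar decomposition. -/
noncomputable def polarPow (h : ℝ) (A : Mat ℂ) : Mat ℂ := cfc (fun x : ℝ => x ^ h) (polarP A)

lemma contOn_spectrum (f : ℝ → ℝ) (A : Mat ℂ) : ContinuousOn f (spectrum ℝ A) :=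
  A.finite_real_spectrum.continuousOn f

lemma isSelfAdjoint_gram (A : Mat ℂ) : IsSelfAdjoint (A * Aᴴ) :=
  (Matrix.isHermitian_mul_conjTranspose_self A).isSelfAdjoint

open scoped ComplexOrder in
lemma spectrum_gram_nonneg (A : Mat ℂ) {x : ℝ} (hx : x ∈ spectrum ℝ (A * Aᴴ)) : 0 ≤ x := by
  have h := Matrix.posSemidef_self_mul_conjTranspose A
  rw [h.isHermitian.spectrum_real_eq_range_eigenvalues] at hx
  obtain ⟨i, rfl⟩ := hx
  exact h.eigenvalues_nonneg i

lemma isSelfAdjoint_polarP (A : Mat ℂ) : IsSelfAdjoint (polarP A) := cfc_predicate _ _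

lemma polarP_mul_self (A : Mat ℂ) : polarP A * polarP A = A * Aᴴ := by
  unfold polarP
  rw [← cfc_mul _ _ _ (contOn_spectrum _ _) (contOn_spectrum _ _)]
  conv_rhs => rw [← cfc_id' ℝ (A * Aᴴ) (isSelfAdjoint_gram A)]
  exact cfc_congr fun x hx => Real.mul_self_sqrt (spectrum_gram_nonneg A hx)

lemma spectrum_polarP_nonneg (A : Mat ℂ) {x : ℝ} (hx : x ∈ spectrum ℝ (polarP A)) : 0 ≤ x := by
  unfold polarP at hx
  rw [cfc_map_spectrum _ _ (isSelfAdjoint_gram A) (contOn_spectrum _ _)] at hx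
  obtain ⟨y, -, rfl⟩ := hx
  exact Real.sqrt_nonneg y

lemma isUnit_polarP {A : Mat ℂ} (hA : A.det ≠ 0) : IsUnit (polarP A) := by
  rw [Matrix.isUnit_iff_isUnit_det, isUnit_iff_ne_zero]
  intro h
  have h2 := congrArg Matrix.det (polarP_mul_self A)
  rw [Matrix.det_mul, Matrix.det_mul, h, Matrix.det_conjTranspose] at h2
  simp [hA] at h2

lemma polarP_smul (c : ℂ) (A : Mat ℂ) : polarP (c • A) = ‖c‖ • polarP A := by
  unfold polarP
  have h1 : (c • A) * (c • A)ᴴ = (‖c‖ ^ 2 : ℝ) • (A * Aᴴ) := by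
    rw [Matrix.conjTranspose_smul, smul_mul_smul_comm, ← Complex.coe_smul]
    congr 1
    rw [Complex.star_def, Complex.mul_conj, Complex.normSq_eq_norm_sq]
  rw [h1, ← cfc_comp_smul (‖c‖ ^ 2 : ℝ) (fun x : ℝ => √x) (A * Aᴴ)
    Real.continuous_sqrt.continuousOn (isSelfAdjoint_gram A),
    ← cfc_smul ‖c‖ (fun x : ℝ => √x) (A * Aᴴ) (contOn_spectrum _ _)]
  congr 1
  ext x
  simp [Real.sqrt_mul, Real.sqrt_sq]

lemma polarU_smul {c : ℂ} (hc : c ≠ 0) (A : Mat ℂ) :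
    polarU (c • A) = (c / ‖c‖) • polarU A := by
  have hn : (‖c‖ : ℂ) ≠ 0 := by simpa using hc
  unfold polarU
  rw [polarP_smul, ← Complex.coe_smul]
  by_cases h : IsUnit (polarP A).det
  · rw [show ((‖c‖ : ℂ) • polarP A)⁻¹ = (‖c‖ : ℂ)⁻¹ • (polarP A)⁻¹ from
      Matrix.inv_smul' _ (Units.mk0 _ hn) h, smul_mul_smul_comm]
    congr 1
    field_simp
  · have h' : ¬ IsUnit ((‖c‖ : ℂ) • polarP A).det := by
      rw [Matrix.det_smul]
      simpa [hn, hc] using h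
    rw [Matrix.nonsing_inv_apply_not_isUnit _ h, Matrix.nonsing_inv_apply_not_isUnit _ h']
    simp

lemma polarPow_smul (h : ℝ) (c : ℂ) (A : Mat ℂ) :
    polarPow h (c • A) = (‖c‖ ^ h) • polarPow h A := by
  unfold polarPow
  rw [polarP_smul, ← cfc_comp_smul ‖c‖ (fun x : ℝ => x ^ h) (polarP A)
    ((Matrix.finite_real_spectrum.image _).continuousOn _) (isSelfAdjoint_polarP A),
    ← cfc_smul (‖c‖ ^ h) (fun x : ℝ => x ^ h) (polarP A) (contOn_spectrum _ _)]
  exact cfc_congr fun x hx => Real.mul_rpow (norm_nonneg c) (spectrum_polarP_nonneg A hx)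

lemma polarU_mem {A : Mat ℂ} (hA : A.det ≠ 0) : polarU A ∈ Matrix.unitaryGroup (Fin 2) ℂ := by
  have hP := (Matrix.isUnit_iff_isUnit_det _).1 (isUnit_polarP hA)
  have hs : (polarP A)ᴴ = polarP A := isSelfAdjoint_polarP A
  rw [Matrix.mem_unitaryGroup_iff, Matrix.star_eq_conjTranspose, polarU,
    Matrix.conjTranspose_mul, Matrix.conjTranspose_nonsing_inv, hs, Matrix.mul_assoc,
    ← Matrix.mul_assoc A, ← polarP_mul_self, Matrix.mul_assoc, Matrix.mul_nonsing_inv _ hP,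
    Matrix.mul_one, Matrix.nonsing_inv_mul _ hP]

lemma polarU_isUnit {A : Mat ℂ} (hA : A.det ≠ 0) : IsUnit (polarU A) :=
  IsUnit.of_mul_eq_one _ (Matrix.mem_unitaryGroup_iff.1 (polarU_mem hA))

lemma polarU_ne_zero {A : Mat ℂ} (hA : A.det ≠ 0) : polarU A ≠ 0 :=
  (polarU_isUnit hA).ne_zero

lemma polarPow_mul_polarU_ne_zero (h : ℝ) {A : Mat ℂ} (hA : A.det ≠ 0) :
    polarPow h A * polarU A ≠ 0 := by
  refine (IsUnit.mul ?_ (polarU_isUnit hA)).ne_zero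
  refine (isUnit_cfc_iff _ _ (contOn_spectrum _ _) (isSelfAdjoint_polarP A)).2 fun x hx => ?_
  have h0 : x ≠ 0 := by
    rintro rfl
    exact (spectrum.zero_notMem_iff ℝ).2 (isUnit_polarP hA) hx
  exact (Real.rpow_pos_of_pos (lt_of_le_of_ne (spectrum_polarP_nonneg A hx) h0.symm) h).ne'

open Classical in
/-- The map `R_h` on `ℂP³`: `R_h [P U] = [P ^ h U]` on `PSL₂(ℂ)`, and the identity on `Q`. -/
noncomputable def powMap (h : ℝ) : P3 ℂ → P3 ℂ :=
  Projectivization.lift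
    (fun A => if hA : A.1.det = 0 then Projectivization.mk ℂ A.1 A.2 else
      Projectivization.mk ℂ (polarPow h A.1 * polarU A.1) (polarPow_mul_polarU_ne_zero h hA))
    (by
      rintro ⟨_, hA⟩ ⟨B, hB⟩ c rfl
      have hc : c ≠ 0 := by rintro rfl; simp at hA
      by_cases hd : B.det = 0
      · simp [hd, Projectivization.mk_eq_mk_iff']
      · simp only [Matrix.det_smul, mul_eq_zero, hd, or_false, Fintype.card_fin,
          pow_eq_zero_iff two_ne_zero, hc, dite_false, Projectivization.mk_eq_mk_iff']
        refine ⟨((‖c‖ ^ h : ℝ) : ℂ) * (c / ‖c‖), ?_⟩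
        rw [polarPow_smul, polarU_smul hc, ← Complex.coe_smul, smul_mul_smul_comm])

open Classical in
/-- The class of the unitary factor of the polar decomposition (extended by the identity
to `Q`). -/
noncomputable def unitaryClass : P3 ℂ → P3 ℂ :=
  Projectivization.lift
    (fun A => if hA : A.1.det = 0 then Projectivization.mk ℂ A.1 A.2 else
      Projectivization.mk ℂ (polarU A.1) (polarU_ne_zero hA))
    (by
      rintro ⟨_, hA⟩ ⟨B, hB⟩ c rfl
      have hc : c ≠ 0 := by rintro rfl; simp at hA
      by_cases hd : B.det = 0
      · simp [hd, Projectivization.mk_eq_mk_iff']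
      · simp only [Matrix.det_smul, mul_eq_zero, hd, or_false, Fintype.card_fin,
          pow_eq_zero_iff two_ne_zero, hc, dite_false, Projectivization.mk_eq_mk_iff']
        exact ⟨c / ‖c‖, (polarU_smul hc B).symm⟩)

/-- The spherical coamoeba map `ϰ° : PSL₂(ℂ) → PSU(2)`, `[P U] ↦ [U]`. -/
noncomputable def sphericalCoamoeba (x : PSL2) : PSU2 :=
  ⟨unitaryClass x.1, by
    obtain ⟨x, hx⟩ := x
    induction x using Projectivization.ind with
    | h A hA =>
      rw [mk_mem_quadric] at hx
      exact ⟨polarU A, polarU_ne_zero hx, polarU_mem hx, by simp [unitaryClass, hx]⟩⟩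

/-! ### The circle bundle and the cone picture of `ℂP³` -/

/-- The total space of the circle bundle `𝓢` over `Q`: the classes `[B]_{ℝ*}` of nonzero complex
matrices of zero determinant modulo nonzero real scalars. The fibre over `[B]_{ℂ*}` is
`{[c B]_{ℝ*} | c ∈ ℂ*}`. -/
def circleBundle : Set (Projectivization ℝ (Mat ℂ)) :=
  {s | ∃ (B : Mat ℂ) (hB : B ≠ 0), B.det = 0 ∧ s = Projectivization.mk ℝ B hB}

/-- The map `[B]_{ℝ*} ↦ [B]_{ℂ*}`. -/
noncomputable def complexClass : Projectivization ℝ (Mat ℂ) → P3 ℂ :=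
  Projectivization.lift (fun B => Projectivization.mk ℂ B.1 B.2) (by
    rintro ⟨_, hA⟩ ⟨B, hB⟩ c rfl
    exact (Projectivization.mk_eq_mk_iff' ..).2 ⟨(c : ℂ), by simp⟩)

/-- The matrix `e^α B + e^{-α} (B^c)^*`, where `B^c` is the adjugate of `B`. -/
noncomputable def coneMatrix (α : ℝ) (B : Mat ℂ) : Mat ℂ :=
  Real.exp α • B + Real.exp (-α) • B.adjugateᴴ

lemma coneMatrix_smul (α r : ℝ) (B : Mat ℂ) : coneMatrix α (r • B) = r • coneMatrix α B := by
  ext i j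
  fin_cases i <;> fin_cases j <;>
    simp [coneMatrix, Matrix.adjugate_fin_two] <;> ring

lemma coneMatrix_ne_zero {α : ℝ} (hα : 0 < α) {B : Mat ℂ} (hB : B ≠ 0) :
    coneMatrix α B ≠ 0 := by
  have hab : Real.exp α * Real.exp α - Real.exp (-α) * Real.exp (-α) ≠ 0 := by
    rw [← Real.exp_add, ← Real.exp_add, sub_ne_zero]
    intro h
    have := Real.exp_injective h
    linarith
  unfold coneMatrix
  generalize Real.exp α = a at *
  generalize Real.exp (-α) = b at *
  have key : ∀ (x y : ℂ), (a : ℂ) * x + b * y = 0 → (a : ℂ) * y + b * x = 0 → x = 0 := by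
    intro x y h1 h2
    have h3 : ((a * a - b * b : ℝ) : ℂ) * x = 0 := by
      push_cast
      linear_combination (a : ℂ) * h1 - (b : ℂ) * h2
    exact (mul_eq_zero.1 h3).resolve_left (Complex.ofReal_ne_zero.2 hab)
  have cj : ∀ (x y : ℂ), (a : ℂ) * x + b * y = 0 →
      (a : ℂ) * (starRingEnd ℂ) x + b * (starRingEnd ℂ) y = 0 := by
    intro x y h
    simpa using congrArg (starRingEnd ℂ) h
  intro h
  apply hB
  have h00 := congrFun (congrFun h 0) 0
  have h01 := congrFun (congrFun h 0) 1
  have h10 := congrFun (congrFun h 1) 0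
  have h11 := congrFun (congrFun h 1) 1
  simp only [Matrix.adjugate_fin_two, Matrix.add_apply, Matrix.smul_apply,
    Matrix.conjTranspose_apply, Matrix.of_apply, Matrix.cons_val', Matrix.cons_val_zero,
    Matrix.cons_val_one, Matrix.cons_val_fin_one, Complex.real_smul, Complex.star_def,
    Matrix.zero_apply, map_neg] at h00 h01 h10 h11
  have c00 := cj _ _ h00
  have c01 := cj _ _ h01
  have c10 := cj _ _ h10
  have c11 := cj _ _ h11
  simp only [Complex.conj_conj, map_neg] at c00 c01 c10 c11
  ext i j
  fin_cases i <;> fin_cases j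
  · exact key _ _ h00 c11
  · have : B 0 1 = 0 := key _ _ h01 (by linear_combination -c10)
    exact this
  · have : B 1 0 = 0 := key _ _ h10 (by linear_combination -c01)
    exact this
  · exact key _ _ h11 c00

/-- The cone picture of `ℂP³`: the vertex carries the fibre `PSU(2)`, the points at height
`α ∈ (0, ∞)` carry the circle bundle, and the base at height `∞` is `Q`. -/
inductive ConePoint : Type
  | vertex (U : PSU2) : ConePoint
  | inner (α : Set.Ioi (0 : ℝ)) (s : circleBundle) : ConePoint
  | base (x : quadric) : ConePoint

/-- The identification of the cone picture with `ℂP³`: the inclusions on `PSU(2)` and on `Q`, and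
`(α, [B]_{ℝ*}) ↦ [e^α B + e^{-α} (B^c)^*]_{ℂ*}` in between. -/
noncomputable def ConePoint.toP3 : ConePoint → P3 ℂ
  | .vertex U => U.1
  | .inner α s => Projectivization.lift
      (fun B => Projectivization.mk ℂ (coneMatrix α.1 B.1) (coneMatrix_ne_zero α.2 B.2)) (by
        rintro ⟨_, hA⟩ ⟨B, hB⟩ c rfl
        exact (Projectivization.mk_eq_mk_iff' ..).2 ⟨(c : ℂ), by simp [coneMatrix_smul]⟩) s.1
  | .base x => x.1

/-! ### The field `𝕂` and the matrix valuation -/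

/-- The field of Hahn series with real exponents and complex coefficients in the variable `t → ∞`.
The coefficient `f.coeff γ` is that of `t ^ (-γ)`, so supports are well-ordered in `t⁻¹`. -/
abbrev KK : Type := HahnSeries ℝ ℂ

/-- The value at `t` of a Hahn series (meaningful when the series converges). -/
noncomputable def seriesEval (f : KK) (t : ℝ) : ℂ := ∑' γ : ℝ, f.coeff γ * ((t ^ (-γ) : ℝ) : ℂ)

/-- The series converges (absolutely) for all large real `t`. -/
def IsConvergent (f : KK) : Prop :=
  ∀ᶠ t : ℝ in atTop, Summable fun γ : ℝ => f.coeff γ * ((t ^ (-γ) : ℝ) : ℂ)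

open Classical in
/-- The class `[A]` in `ℂP³` of a matrix, with the value `[1]` at the zero matrix. -/
noncomputable def classOf (A : Mat ℂ) : P3 ℂ :=
  if hA : A = 0 then Projectivization.mk ℂ 1 one_ne_zero else Projectivization.mk ℂ A hA

/-- `A = B t ^ α + o(t ^ α)` with `B` a nonzero complex matrix. -/
def HasLeadingTerm (A : Mat KK) (α : ℝ) (B : Mat ℂ) : Prop :=
  B ≠ 0 ∧ ∀ i j, (A i j).coeff (-α) = B i j ∧ ∀ β > α, (A i j).coeff (-β) = 0

/-- `x` is the limit of `R_{1 / log t} [A(t)]` as `t → ∞`. -/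
def IsPhaseLimit (A : Mat KK) (x : P3 ℂ) : Prop :=
  Tendsto (fun t : ℝ => powMap (Real.log t)⁻¹ (classOf (A.map fun f => seriesEval f t)))
    atTop (𝓝 x)

/-- `x` is the matrix valuation of `p = [A]`. If the entries of `A` converge, then `x` is the
limit of `R_{1 / log t} [A(t)]` (take `A' = A`). Since this limit depends only on the determinant
and on the top order term of the matrix, it is computed in general from any matrix `A'` with
convergent entries, the same determinant and the same top order term. -/
def IsMatrixValuation (p : P3 KK) (x : P3 ℂ) : Prop :=
  ∃ (A : Mat KK) (hA : A ≠ 0) (A' : Mat KK) (α : ℝ) (B : Mat ℂ),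
    p = Projectivization.mk KK A hA ∧ A'.det = A.det ∧
    HasLeadingTerm A α B ∧ HasLeadingTerm A' α B ∧
    (∀ i j, IsConvergent (A' i j)) ∧ IsPhaseLimit A' x

/-- The matrix valuation `VAL : 𝕂P³ → ℂP³`. -/
noncomputable def VAL (p : P3 KK) : P3 ℂ := Classical.epsilon (IsMatrixValuation p)

/-! ### Subvarieties of `ℂP³` and their `𝕂`-points -/

/-- Polynomials over `ℂ` in the four matrix entries. -/
abbrev EntryPoly : Type := MvPolynomial (Fin 2 × Fin 2) ℂ

/-- The homogeneous polynomials. -/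
def homogeneousPolys : Set EntryPoly := {f | ∃ d : ℕ, f.IsHomogeneous d}

/-- The common zeros in `P³(L)` of a set of (homogeneous) polynomials over `ℂ`, for a field
extension `φ : ℂ → L`. -/
def zeroSet {L : Type*} [Field L] (φ : ℂ →+* L) (F : Set EntryPoly) : Set (P3 L) :=
  {p | ∀ f ∈ F, ∀ (A : Mat L) (hA : A ≠ 0), p = Projectivization.mk L A hA →
    MvPolynomial.eval₂ φ (fun ij => A ij.1 ij.2) f = 0}

/-- `V` is a (closed, possibly reducible) subvariety of `ℂP³`. -/
def IsSubvariety (V : Set (P3 ℂ)) : Prop := ∃ F ⊆ homogeneousPolys, V = zeroSet (RingHom.id ℂ) F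

/-- The subset `W` of `ℂP³` is irreducible in the Zariski topology. -/
def IsIrredSubvariety (W : Set (P3 ℂ)) : Prop :=
  IsSubvariety W ∧ W.Nonempty ∧
    ∀ Z₁ Z₂, IsSubvariety Z₁ → IsSubvariety Z₂ → W ⊆ Z₁ ∪ Z₂ → W ⊆ Z₁ ∨ W ⊆ Z₂

/-- `W` is an irreducible component of `V`: a maximal irreducible subvariety of `V`. -/
def IsIrredComponent (V W : Set (P3 ℂ)) : Prop :=
  Maximal (fun W => IsIrredSubvariety W ∧ W ⊆ V) W

/-- The homogeneous polynomials that vanish on `V`. -/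
def vanishingPolys (V : Set (P3 ℂ)) : Set EntryPoly :=
  {f ∈ homogeneousPolys | V ⊆ zeroSet (RingHom.id ℂ) {f}}

/-- The set `V(𝕂)` of `𝕂`-points of `V`. -/
noncomputable def pointsKK (V : Set (P3 ℂ)) : Set (P3 KK) :=
  zeroSet HahnSeries.C (vanishingPolys V)

/-!
For a matrix `A = P U` in polar form, the matrix `P^c U = (det A / |det A|) (A^c)^*` is `A` with its
two singular values exchanged, and `P ^ h U` is an explicit real combination of `A` and `P^c U`
(`polarPow_mul_polarU`). If `A(t) ~ B t ^ α` and `det A(t) ~ d t ^ k`, then the singular values to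
the power `1 / log t` tend to `e ^ α` and `e ^ (k - α)`, and so `R_{1 / log t} [A(t)]` tends to
`[e ^ α B + e ^ (k - α) (d / |d|) (B^c)^*]` (`tendsto_powMap`). Evaluation of convergent Hahn series
is multiplicative and asymptotic to the leading term, hence the limit depends only on the top order
term and on the determinant of `A`. Every nonzero Hahn series is a square, so a matrix of nonzero
determinant can be rescaled to determinant `1`, and then it has a companion with finitely supported
entries, `B t ^ α + t ^ (-α) (B^c)^* / |B|²` if `det B = 0`. This gives existence and uniqueness of
the valuation, and a formula for it (`HasLeadingTerm.isMatrixValuation_iff`): for `det B ≠ 0` the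
limit is the class of the unitary factor of `B`; for `det B = 0 ≠ det A` it is a point of the open
cone over the circle over `[B]`; for `det A = 0` it is `[B]`.

For a `𝕂`-point `[A]` of `V` the leading coefficient gives a point `[B]` of `V`, since the equations
are homogeneous; this shows that the image of the valuation lies in the stated set. Conversely, the
complex points of `V` are constant `𝕂`-points and account for the vertex and for the base of the
cone. Over `[B]` in `V ∩ Q` a minimal prime over the ideal of `V` below the ideal of the line `ℂ B`
defines a component of `V`, and so it does not contain the determinant (`exists_prime_through`).
Curve selection (`exists_arc`) provides a formal arc `A(u)` in the cone over this component, with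
`A(0) = B` and `det A(u) = c u ^ m + …`, where `c ≠ 0` and `m > 0`. The substitution
`u = ζ t ^ (-r)` makes `det A ~ c ζ ^ m t ^ (-m r)`, and the choice of `r > 0` and `ζ` reaches every
height and every point of the circle. Curve selection rests on Noether normalization: the preimage
of a suitable line through the image of `B` contains, by going-down, a curve through `B`, and a
branch of its normalization is a discrete valuation ring with residue field `ℂ`, which embeds into
the power series by expansion in a uniformizer.
-/

/-! ### Arcs through a point of an affine variety -/

section Arcs

open Polynomial in
/-- A truncated product differs from the product of the truncations by a multiple of `X ^ n`. -/
lemma PowerSeries.X_pow_dvd_trunc_mul_sub {k : Type*} [CommRing k] (F G : PowerSeries k) (n : ℕ) :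
    (Polynomial.X ^ n : Polynomial k) ∣ trunc n (F * G) - trunc n F * trunc n G := by
  rw [Polynomial.X_pow_dvd_iff]
  intro d hd
  have h := congrArg (fun p => Polynomial.coeff p d) (PowerSeries.trunc_trunc_mul_trunc (n := n) F G)
  simp only [coeff_trunc, hd, if_true, ← Polynomial.coe_mul, Polynomial.coeff_coe] at h
  rw [Polynomial.coeff_sub, coeff_trunc, if_pos hd, ← h, sub_self]

/-- A discrete valuation ring that contains a copy `k` of its residue field embeds into `k⟦X⟧`, by
expansion in powers of a uniformizer. -/
lemma exists_powerSeries_expansion {k D : Type*} [Field k] [CommRing D] [IsDomain D]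
    [IsDiscreteValuationRing D] [Algebra k D]
    (hres : Function.Surjective (algebraMap k (IsLocalRing.ResidueField D))) :
    ∃ Φ : D →ₐ[k] PowerSeries k, Function.Injective Φ ∧
      ∀ x ∈ IsLocalRing.maximalIdeal D, PowerSeries.constantCoeff (Φ x) = 0 := by
  obtain ⟨ϖ, hϖ⟩ := IsDiscreteValuationRing.exists_irreducible D
  have hmax := hϖ.maximalIdeal_eq
  -- `F` represents `x` if its partial sums converge to `x` in the `ϖ`-adic topology
  let Rep : D → PowerSeries k → Prop := fun x F =>
    ∀ n, ϖ ^ n ∣ x - Polynomial.aeval ϖ (PowerSeries.trunc n F)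
  have hstep : ∀ x : D, ∃ c : k, ∃ y : D, x = algebraMap k D c + ϖ * y := by
    intro x
    obtain ⟨c, hc⟩ := hres (IsLocalRing.residue D x)
    have : x - algebraMap k D c ∈ IsLocalRing.maximalIdeal D := by
      rw [← Ideal.Quotient.eq]
      exact hc.symm
    rw [hmax, Ideal.mem_span_singleton] at this
    obtain ⟨y, hy⟩ := this
    exact ⟨c, y, by rw [← hy]; ring⟩
  choose c y hcy using hstep
  have hex : ∀ x, ∃ F, Rep x F := by
    intro x
    refine ⟨PowerSeries.mk fun n => c (y^[n] x), fun n => ⟨y^[n] x, ?_⟩⟩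
    induction n with
    | zero => simp
    | succ n ih =>
      rw [PowerSeries.trunc_succ, map_add, ← sub_sub, ih, PowerSeries.coeff_mk,
        Function.iterate_succ_apply', Polynomial.aeval_monomial]
      linear_combination ϖ ^ n * hcy (y^[n] x)
  have huniq0 : ∀ F, Rep 0 F → F = 0 := by
    intro F hF
    by_contra hne
    obtain ⟨m, hm, hlt⟩ : ∃ m, PowerSeries.coeff m F ≠ 0 ∧ ∀ i < m, PowerSeries.coeff i F = 0 := by
      classical
      have h : ∃ m, PowerSeries.coeff m F ≠ 0 := PowerSeries.exists_coeff_ne_zero_iff_ne_zero.2 hne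
      exact ⟨Nat.find h, Nat.find_spec h, fun i hi => not_not.1 (Nat.find_min h hi)⟩
    have ht : PowerSeries.trunc m F = 0 := by
      ext i
      rw [PowerSeries.coeff_trunc]
      split_ifs with hi
      · simpa using hlt i hi
      · simp
    have h := hF (m + 1)
    rw [PowerSeries.trunc_succ, ht, zero_add, zero_sub, dvd_neg, Polynomial.aeval_monomial,
      pow_succ, mul_comm (algebraMap k D _)] at h
    have h2 := (mul_dvd_mul_iff_left (pow_ne_zero m hϖ.ne_zero)).1 h
    exact hϖ.not_isUnit (isUnit_of_dvd_unit h2 ((isUnit_iff_ne_zero.2 hm).map (algebraMap k D)))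
  have hsub : ∀ x x' F F', Rep x F → Rep x' F' → Rep (x - x') (F - F') := by
    intro x x' F F' h h' n
    have : x - x' - Polynomial.aeval ϖ (PowerSeries.trunc n (F - F')) =
        (x - Polynomial.aeval ϖ (PowerSeries.trunc n F)) -
        (x' - Polynomial.aeval ϖ (PowerSeries.trunc n F')) := by
      rw [PowerSeries.trunc_sub, map_sub]; ring
    rw [this]
    exact dvd_sub (h n) (h' n)
  have huniq : ∀ x F F', Rep x F → Rep x F' → F = F' := by
    intro x F F' h h'
    refine sub_eq_zero.1 (huniq0 _ ?_)
    simpa using hsub x x F F' h h'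
  have hadd : ∀ x x' F F', Rep x F → Rep x' F' → Rep (x + x') (F + F') := by
    intro x x' F F' h h' n
    have : x + x' - Polynomial.aeval ϖ (PowerSeries.trunc n (F + F')) =
        (x - Polynomial.aeval ϖ (PowerSeries.trunc n F)) +
        (x' - Polynomial.aeval ϖ (PowerSeries.trunc n F')) := by
      rw [map_add, map_add]; ring
    rw [this]
    exact dvd_add (h n) (h' n)
  have hmul : ∀ x x' F F', Rep x F → Rep x' F' → Rep (x * x') (F * F') := by
    intro x x' F F' h h' n
    obtain ⟨q, hq⟩ := PowerSeries.X_pow_dvd_trunc_mul_sub F F' n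
    have h1 : x * x' - Polynomial.aeval ϖ (PowerSeries.trunc n (F * F')) =
        (x - Polynomial.aeval ϖ (PowerSeries.trunc n F)) * x' +
        Polynomial.aeval ϖ (PowerSeries.trunc n F) *
          (x' - Polynomial.aeval ϖ (PowerSeries.trunc n F')) - ϖ ^ n * Polynomial.aeval ϖ q := by
      have h2 := congrArg (Polynomial.aeval ϖ) hq
      simp only [map_sub, map_mul, map_pow, Polynomial.aeval_X] at h2
      rw [← h2]; ring
    rw [h1]
    exact dvd_sub (dvd_add (dvd_mul_of_dvd_left (h n) _) (dvd_mul_of_dvd_right (h' n) _))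
      (dvd_mul_right _ _)
  have halg : ∀ a : k, Rep (algebraMap k D a) (PowerSeries.C a) := by
    intro a n
    rcases n with _ | n
    · simp
    · rw [PowerSeries.trunc_C, Polynomial.aeval_C, sub_self]
      exact dvd_zero _
  choose E hE using hex
  let Φ : D →ₐ[k] PowerSeries k :=
    { toFun := E
      map_one' := huniq 1 _ _ (hE 1) (by simpa using halg 1)
      map_zero' := huniq 0 _ _ (hE 0) (by simpa using halg 0)
      map_add' := fun x x' => huniq _ _ _ (hE _) (hadd _ _ _ _ (hE x) (hE x'))
      map_mul' := fun x x' => huniq _ _ _ (hE _) (hmul _ _ _ _ (hE x) (hE x'))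
      commutes' := fun a => huniq _ _ _ (hE _) (halg a) }
  refine ⟨Φ, (injective_iff_map_eq_zero Φ).2 fun x hx => ?_, fun x hx => ?_⟩
  · by_contra hne
    obtain ⟨m, hm⟩ := IsDiscreteValuationRing.associated_pow_irreducible hne hϖ
    have h := hE x (m + 1)
    rw [show E x = 0 from hx, map_zero, map_zero, sub_zero] at h
    have h2 := (hm.dvd_iff_dvd_right).1 h
    rw [pow_succ] at h2
    have h3 : ϖ ^ m * ϖ ∣ ϖ ^ m * 1 := by rwa [mul_one]
    exact hϖ.not_isUnit (isUnit_of_dvd_one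
      ((mul_dvd_mul_iff_left (pow_ne_zero m hϖ.ne_zero)).1 h3))
  · by_contra hne
    rw [← PowerSeries.coeff_zero_eq_constantCoeff_apply] at hne
    have h := hE x 1
    rw [hmax, Ideal.mem_span_singleton] at hx
    rw [PowerSeries.trunc_one_left, Polynomial.aeval_C, pow_one] at h
    have h2 := (dvd_sub_right hx).1 h
    exact hϖ.not_isUnit (isUnit_of_dvd_unit h2 ((isUnit_iff_ne_zero.2 hne).map (algebraMap k D)))

/-- A domain `T` that is finite over `k[X]` has, at each prime over the origin, an injective
parametrization by power series: a branch of the curve `Spec T`. -/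
lemma exists_branch {k T : Type*} [Field k] [IsAlgClosed k] [CharZero k] [CommRing T] [IsDomain T]
    [Algebra k T] [Algebra (Polynomial k) T] [IsScalarTower k (Polynomial k) T]
    [Module.Finite (Polynomial k) T] [FaithfulSMul (Polynomial k) T] (n : Ideal T) [n.IsPrime]
    (hX : algebraMap (Polynomial k) T Polynomial.X ∈ n) :
    ∃ Φ : T →ₐ[k] PowerSeries k, Function.Injective Φ ∧
      ∀ x ∈ n, PowerSeries.constantCoeff (Φ x) = 0 := by
  let A := Polynomial k
  let F := FractionRing T
  let : Algebra (FractionRing A) F := FractionRing.liftAlgebra A F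
  have : IsScalarTower A (FractionRing A) F := FractionRing.isScalarTower_liftAlgebra A F
  have : FiniteDimensional (FractionRing A) F := .of_isLocalization A T (nonZeroDivisors A)
  let C := integralClosure A F
  have : IsDedekindDomain C := integralClosure.isDedekindDomain A (FractionRing A) F
  let : Algebra T C := (((IsScalarTower.toAlgHom A T F).codRestrict C
    (fun x => (Algebra.IsIntegral.isIntegral (R := A) x).map (IsScalarTower.toAlgHom A T F))
      ).toRingHom).toAlgebra
  have : IsScalarTower A T C := IsScalarTower.of_algebraMap_eq fun x => by
    apply Subtype.ext
    exact IsScalarTower.algebraMap_apply A T F x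
  have : Algebra.IsIntegral T C := Algebra.IsIntegral.tower_top (R := A)
  have hinj : Function.Injective (algebraMap T C) := fun x y hxy =>
    IsFractionRing.injective T F (congrArg Subtype.val hxy)
  obtain ⟨P, -, hP, hPn⟩ := Ideal.exists_ideal_over_prime_of_isIntegral n (⊥ : Ideal C) (by
    rw [← RingHom.ker_eq_comap_bot, (RingHom.injective_iff_ker_eq_bot _).1 hinj]; exact bot_le)
  have hXP : algebraMap A C Polynomial.X ∈ P := by
    rw [IsScalarTower.algebraMap_apply A T C, ← Ideal.mem_comap, hPn]
    exact hX
  have hAC : Function.Injective (algebraMap A C) := by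
    rw [IsScalarTower.algebraMap_eq A T C]
    exact hinj.comp (FaithfulSMul.algebraMap_injective A T)
  have hPbot : P ≠ ⊥ := by
    rintro rfl
    rw [Ideal.mem_bot, map_eq_zero_iff _ hAC] at hXP
    exact Polynomial.X_ne_zero hXP
  have : P.IsMaximal := hP.isMaximal hPbot
  -- the residue field of the branch is integral over `k`, hence equal to `k`
  have : Algebra.IsIntegral k (C ⧸ P) := by
    have h1 : ((algebraMap k (C ⧸ P)).comp (Polynomial.evalRingHom 0)).IsIntegral := by
      have : (algebraMap k (C ⧸ P)).comp (Polynomial.evalRingHom 0) =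
          (Ideal.Quotient.mk P).comp (algebraMap A C) := by
        apply Polynomial.ringHom_ext
        · intro a
          simp only [RingHom.comp_apply, Polynomial.coe_evalRingHom, Polynomial.eval_C]
          rw [IsScalarTower.algebraMap_apply k C (C ⧸ P), IsScalarTower.algebraMap_apply k A C]
          rfl
        · simp only [RingHom.comp_apply, Polynomial.coe_evalRingHom, Polynomial.eval_X, map_zero]
          exact (Ideal.Quotient.eq_zero_iff_mem.2 hXP).symm
      rw [this]
      exact (algebraMap_isIntegral_iff.2 inferInstance).trans _ _
        (RingHom.isIntegral_of_surjective _ Ideal.Quotient.mk_surjective)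
    exact algebraMap_isIntegral_iff.1 (RingHom.IsIntegral.tower_top _ _ h1)
  have hbij : Function.Bijective (algebraMap k (C ⧸ P)) :=
    IsAlgClosed.algebraMap_bijective_of_isIntegral
  let D := Localization.AtPrime P
  have : IsDiscreteValuationRing D :=
    IsLocalization.AtPrime.isDiscreteValuationRing_of_dedekind_domain C hPbot D
  have hres : Function.Surjective (algebraMap k (IsLocalRing.ResidueField D)) := by
    have h := (P.bijective_algebraMap_quotient_residueField).surjective.comp hbij.surjective
    have hcomp : ⇑(algebraMap k (IsLocalRing.ResidueField D)) =
        algebraMap (C ⧸ P) P.ResidueField ∘ algebraMap k (C ⧸ P) := by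
      funext x
      change algebraMap k P.ResidueField x = _
      rw [Function.comp_apply, IsScalarTower.algebraMap_apply k C P.ResidueField]
      rfl
    rw [hcomp]
    exact h
  obtain ⟨Φ, hΦ, hΦ0⟩ := exists_powerSeries_expansion hres
  let ι : T →ₐ[k] D :=
    { (algebraMap C D).comp (algebraMap T C) with
      commutes' := fun r => by
        change algebraMap C D (algebraMap T C (algebraMap k T r)) = _
        rw [IsScalarTower.algebraMap_apply k A T, ← IsScalarTower.algebraMap_apply A T C,
          ← IsScalarTower.algebraMap_apply k A C, ← IsScalarTower.algebraMap_apply k C D] }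
  have hι : Function.Injective ι :=
    (IsLocalization.injective D P.primeCompl_le_nonZeroDivisors).comp hinj
  refine ⟨Φ.comp ι, hΦ.comp hι, fun x hx => hΦ0 _ ?_⟩
  refine (IsLocalization.AtPrime.to_map_mem_maximal_iff D P _).2 ?_
  rw [← Ideal.mem_comap, hPn]
  exact hx

/-- Curve selection: if `b` is a point of the affine variety with prime ideal `𝔭` and `h` vanishes
at `b` but not on the whole variety, then some formal arc through `b` inside the variety is not
contained in the zero set of `h`. A finite projection to an affine space reduces the claim to a
line through the image of `b`, over which going-down provides a curve through `b`. -/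
lemma exists_arc {k σ : Type*} [Field k] [IsAlgClosed k] [CharZero k] [Finite σ]
    (𝔭 : Ideal (MvPolynomial σ k)) [𝔭.IsPrime] (b : σ → k)
    (hb : ∀ f ∈ 𝔭, MvPolynomial.eval b f = 0) {h : MvPolynomial σ k} (hh : h ∉ 𝔭)
    (hhb : MvPolynomial.eval b h = 0) :
    ∃ Φ : MvPolynomial σ k →ₐ[k] PowerSeries k, (∀ f ∈ 𝔭, Φ f = 0) ∧ Φ h ≠ 0 ∧
      ∀ f, PowerSeries.constantCoeff (Φ f) = MvPolynomial.eval b f := by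
  let S := MvPolynomial σ k
  let R := S ⧸ 𝔭
  let ev : R →ₐ[k] k := Ideal.Quotient.liftₐ 𝔭 (MvPolynomial.aeval b) fun f hf => by
    rw [MvPolynomial.aeval_eq_eval]; exact hb f hf
  have hev : ∀ f : S, ev (Ideal.Quotient.mk 𝔭 f) = MvPolynomial.eval b f := fun f => by
    rw [← MvPolynomial.aeval_eq_eval]; rfl
  obtain ⟨s, g, hg, hgint⟩ := exists_integral_inj_algHom_of_fg k R
  let A := MvPolynomial (Fin s) k
  let z₀ : Fin s → k := fun i => ev (g (MvPolynomial.X i))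
  have hz₀ : ∀ f : A, ev (g f) = MvPolynomial.eval z₀ f := by
    intro f
    have : ev.comp g = MvPolynomial.aeval z₀ := MvPolynomial.algHom_ext fun i => by simp [z₀]
    rw [← MvPolynomial.aeval_eq_eval]
    exact DFunLike.congr_fun this f
  let : Algebra A R := g.toRingHom.toAlgebra
  have : Algebra.IsIntegral A R := ⟨hgint⟩
  have : FaithfulSMul A R := (faithfulSMul_iff_algebraMap_injective A R).2 hg
  have hhR : Ideal.Quotient.mk 𝔭 h ≠ 0 := fun h0 => hh (Ideal.Quotient.eq_zero_iff_mem.1 h0)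
  -- a nonzero polynomial on the affine space that vanishes wherever `h` does
  obtain ⟨N, hN, hdvd⟩ := (Algebra.IsAlgebraic.isAlgebraic (R := A)
    (Ideal.Quotient.mk 𝔭 h)).exists_nonzero_dvd (mem_nonZeroDivisors_of_ne_zero hhR)
  replace hdvd : Ideal.Quotient.mk 𝔭 h ∣ g N := hdvd
  obtain ⟨z₁, hz₁⟩ : ∃ z₁, MvPolynomial.eval z₁ N ≠ 0 := by
    by_contra! hall
    exact hN (MvPolynomial.funext fun x => by rw [hall x, map_zero])
  have hNz₀ : MvPolynomial.eval z₀ N = 0 := by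
    rw [← hz₀]
    obtain ⟨w, hw⟩ := hdvd
    rw [hw, map_mul, hev, hhb, zero_mul]
  obtain ⟨i, hi⟩ : ∃ i, z₁ i - z₀ i ≠ 0 := by
    by_contra! hall
    apply hz₁
    rw [show z₁ = z₀ from funext fun i => sub_eq_zero.1 (hall i), hNz₀]
  -- restriction to the line through `z₀` and `z₁`, and a section of it
  let φ : A →ₐ[k] Polynomial k := MvPolynomial.aeval fun i =>
    Polynomial.C (z₀ i) + Polynomial.X * Polynomial.C (z₁ i - z₀ i)
  let lam : Polynomial k →ₐ[k] A := Polynomial.aeval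
    ((MvPolynomial.X i - MvPolynomial.C (z₀ i)) * MvPolynomial.C (z₁ i - z₀ i)⁻¹)
  have hφlam : ∀ f, φ (lam f) = f := by
    intro f
    have : φ.comp lam = AlgHom.id k _ := by
      apply Polynomial.algHom_ext
      have hφX : φ (MvPolynomial.X i) =
          Polynomial.C (z₀ i) + Polynomial.X * Polynomial.C (z₁ i - z₀ i) :=
        MvPolynomial.aeval_X _ _
      have hφC : ∀ a, φ (MvPolynomial.C a) = Polynomial.C a := φ.commutes
      rw [AlgHom.comp_apply, Polynomial.aeval_X, map_mul, map_sub, hφX, hφC, hφC,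
        add_sub_cancel_left, mul_assoc, ← Polynomial.C_mul, mul_inv_cancel₀ hi, Polynomial.C_1,
        mul_one, AlgHom.id_apply]
    exact DFunLike.congr_fun this f
  have hφ₀ : ∀ f, (φ f).eval 0 = MvPolynomial.eval z₀ f := by
    intro f
    have : (Polynomial.aeval (0 : k)).comp φ = MvPolynomial.aeval z₀ :=
      MvPolynomial.algHom_ext fun i => by simp [φ]
    rw [← MvPolynomial.aeval_eq_eval, ← Polynomial.coe_aeval_eq_eval]
    exact DFunLike.congr_fun this f
  have hφ₁ : ∀ f, (φ f).eval 1 = MvPolynomial.eval z₁ f := by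
    intro f
    have : (Polynomial.aeval (1 : k)).comp φ = MvPolynomial.aeval z₁ :=
      MvPolynomial.algHom_ext fun i => by simp [φ]
    rw [← MvPolynomial.aeval_eq_eval, ← Polynomial.coe_aeval_eq_eval]
    exact DFunLike.congr_fun this f
  let p : Ideal A := RingHom.ker φ
  let m : Ideal R := RingHom.ker ev
  have : p.IsPrime := RingHom.ker_isPrime φ
  have : m.IsPrime := RingHom.ker_isPrime ev
  have hNp : N ∉ p := fun hmem => hz₁ (by
    rw [← hφ₁, (RingHom.mem_ker).1 hmem, Polynomial.eval_zero])
  obtain ⟨q, hqm, hq, hqp⟩ := Ideal.exists_ideal_le_liesOver_of_le (p := p) (q := m.under A) m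
    fun f hf => by
      change ev (g f) = 0
      rw [hz₀, ← hφ₀, (RingHom.mem_ker).1 hf, Polynomial.eval_zero]
  have hqp' : ∀ f : A, g f ∈ q ↔ φ f = 0 := fun f => by
    have h1 : f ∈ p ↔ f ∈ q.under A := by rw [← hqp.over]
    exact h1.symm
  let T := R ⧸ q
  let ψ : Polynomial k →ₐ[k] T := ((Ideal.Quotient.mkₐ k q).comp g).comp lam
  let : Algebra (Polynomial k) T := ψ.toRingHom.toAlgebra
  have : IsScalarTower k (Polynomial k) T :=
    IsScalarTower.of_algebraMap_eq fun x => (ψ.commutes x).symm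
  have : FaithfulSMul (Polynomial k) T := by
    refine (faithfulSMul_iff_algebraMap_injective _ _).2
      ((injective_iff_map_eq_zero ψ).2 fun f hf => ?_)
    have : g (lam f) ∈ q := Ideal.Quotient.eq_zero_iff_mem.1 hf
    rwa [hqp', hφlam] at this
  have hψint : ψ.toRingHom.IsIntegral := by
    have h1 : ψ.toRingHom.comp φ.toRingHom = (Ideal.Quotient.mk q).comp g.toRingHom := by
      refine RingHom.ext fun f => Ideal.Quotient.eq.2 ?_
      change g (lam (φ f)) - g f ∈ q
      rw [← map_sub, hqp', map_sub, hφlam, sub_self]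
    have h2 : (ψ.toRingHom.comp φ.toRingHom).IsIntegral := by
      rw [h1]
      exact hgint.trans _ _ (RingHom.isIntegral_of_surjective _ Ideal.Quotient.mk_surjective)
    exact RingHom.IsIntegral.tower_top _ _ h2
  have : Algebra.IsIntegral (Polynomial k) T := ⟨hψint⟩
  have : Algebra.FiniteType (Polynomial k) T :=
    Algebra.FiniteType.of_restrictScalars_finiteType k (Polynomial k) T
  have : Module.Finite (Polynomial k) T := Algebra.IsIntegral.finite
  let e : T →ₐ[k] k := Ideal.Quotient.liftₐ q ev fun x hx => hqm hx
  let n : Ideal T := RingHom.ker e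
  have : n.IsPrime := RingHom.ker_isPrime e
  obtain ⟨Φ, hΦ, hΦ0⟩ := exists_branch (k := k) n (by
    change ev (g (lam Polynomial.X)) = 0
    rw [hz₀]
    simp [lam])
  let π : S →ₐ[k] T := (Ideal.Quotient.mkₐ k q).comp (Ideal.Quotient.mkₐ k 𝔭)
  refine ⟨Φ.comp π, fun f hf => ?_, fun h0 => ?_, fun f => ?_⟩
  · have : π f = 0 := by
      change Ideal.Quotient.mk q (Ideal.Quotient.mk 𝔭 f) = 0
      rw [Ideal.Quotient.eq_zero_iff_mem.2 hf, map_zero]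
    rw [AlgHom.comp_apply, this, map_zero]
  · have h1 : π h = 0 := hΦ (by rw [map_zero]; exact h0)
    have h2 : Ideal.Quotient.mk 𝔭 h ∈ q := Ideal.Quotient.eq_zero_iff_mem.1 h1
    exact hNp ((hqp' N).1 (q.mem_of_dvd hdvd h2))
  · have h1 : π (f - MvPolynomial.C (MvPolynomial.eval b f)) ∈ n := by
      change ev (Ideal.Quotient.mk 𝔭 _) = 0
      rw [hev]; simp
    have h2 := hΦ0 _ h1
    rw [map_sub, map_sub, map_sub, sub_eq_zero, ← MvPolynomial.algebraMap_eq, AlgHom.commutes,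
      AlgHom.commutes] at h2
    rw [AlgHom.comp_apply, h2]
    simp

end Arcs

/-! ### Irreducible components of a projective variety and homogeneous prime ideals -/

section Components

open MvPolynomial

lemma MvPolynomial.IsHomogeneous.eval₂_smul {R L σ : Type*} [CommSemiring R] [CommSemiring L]
    {f : MvPolynomial σ R} {d : ℕ} (hf : f.IsHomogeneous d) (φ : R →+* L) (c : L) (x : σ → L) :
    MvPolynomial.eval₂ φ (fun i => c * x i) f = c ^ d * MvPolynomial.eval₂ φ x f := by
  rw [MvPolynomial.eval₂_eq, MvPolynomial.eval₂_eq, Finset.mul_sum]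
  refine Finset.sum_congr rfl fun m hm => ?_
  have hd : m.degree = d := by
    rw [Finsupp.degree_eq_weight_one]
    exact hf (MvPolynomial.mem_support_iff.1 hm)
  simp only [mul_pow, Finset.prod_mul_distrib, Finset.prod_pow_eq_pow_sum]
  rw [show ∑ i ∈ m.support, m i = d from hd]
  ring

lemma mem_zeroSet_mk {L : Type*} [Field L] (φ : ℂ →+* L) {F : Set EntryPoly}
    (hF : F ⊆ homogeneousPolys) {A : Mat L} (hA : A ≠ 0) :
    Projectivization.mk L A hA ∈ zeroSet φ F ↔
      ∀ f ∈ F, eval₂ φ (fun ij => A ij.1 ij.2) f = 0 := by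
  refine ⟨fun h f hf => h f hf A hA rfl, fun h f hf A' hA' he => ?_⟩
  obtain ⟨d, hd⟩ := hF hf
  obtain ⟨c, hc⟩ := (Projectivization.mk_eq_mk_iff' ..).1 he
  have hc0 : c ≠ 0 := by rintro rfl; exact hA (by simpa using hc.symm)
  have h1 := h f hf
  subst hc
  simp only [Matrix.smul_apply, smul_eq_mul] at h1
  rw [hd.eval₂_smul φ c] at h1
  exact (mul_eq_zero.1 h1).resolve_left (pow_ne_zero _ hc0)

lemma mem_zeroSet_mk_complex {F : Set EntryPoly} (hF : F ⊆ homogeneousPolys) {A : Mat ℂ}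
    (hA : A ≠ 0) : Projectivization.mk ℂ A hA ∈ zeroSet (RingHom.id ℂ) F ↔
      ∀ f ∈ F, eval (fun ij => A ij.1 ij.2) f = 0 :=
  mem_zeroSet_mk _ hF hA

lemma vanishingPolys_subset (V : Set (P3 ℂ)) : vanishingPolys V ⊆ homogeneousPolys :=
  fun _ hf => hf.1

lemma mem_vanishingPolys {V : Set (P3 ℂ)} {f : EntryPoly} :
    f ∈ vanishingPolys V ↔ f ∈ homogeneousPolys ∧
      ∀ (A : Mat ℂ) (hA : A ≠ 0), Projectivization.mk ℂ A hA ∈ V →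
        eval (fun ij => A ij.1 ij.2) f = 0 := by
  refine and_congr_right fun hf => ⟨fun h A hA hV => ?_, fun h x hx => ?_⟩
  · exact (mem_zeroSet_mk_complex (Set.singleton_subset_iff.2 hf) hA).1 (h hV) f rfl
  · induction x using Projectivization.ind with
    | h A hA =>
      refine (mem_zeroSet_mk_complex (Set.singleton_subset_iff.2 hf) hA).2 ?_
      rintro g rfl
      exact h A hA hx

lemma vanishingPolys_anti {V W : Set (P3 ℂ)} (h : W ⊆ V) : vanishingPolys V ⊆ vanishingPolys W :=
  fun _ hf => ⟨hf.1, h.trans hf.2⟩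

/-- A subvariety is the zero set of the homogeneous polynomials that vanish on it. -/
lemma zeroSet_vanishingPolys {V : Set (P3 ℂ)} (hV : IsSubvariety V) :
    zeroSet (RingHom.id ℂ) (vanishingPolys V) = V := by
  obtain ⟨F, hF, rfl⟩ := hV
  apply Set.Subset.antisymm
  · refine fun x hx f hf => hx f ⟨hF hf, fun y hy g hg => ?_⟩
    obtain rfl : g = f := hg
    exact hy g hf
  · exact fun x hx f hf => hf.2 hx f rfl

/-- The determinant as a polynomial in the matrix entries. -/
noncomputable def detPoly : EntryPoly := X (0, 0) * X (1, 1) - X (0, 1) * X (1, 0)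

lemma eval₂_detPoly {L : Type*} [CommRing L] (φ : ℂ →+* L) (A : Mat L) :
    eval₂ φ (fun ij => A ij.1 ij.2) detPoly = A.det := by
  simp [detPoly, Matrix.det_fin_two, eval₂_sub]

lemma eval_detPoly (A : Mat ℂ) : eval (fun ij => A ij.1 ij.2) detPoly = A.det :=
  eval₂_detPoly _ A

lemma detPoly_mem : detPoly ∈ homogeneousPolys :=
  ⟨2, ((isHomogeneous_X _ _).mul (isHomogeneous_X _ _)).sub
    ((isHomogeneous_X _ _).mul (isHomogeneous_X _ _))⟩

attribute [local instance] MvPolynomial.gradedAlgebra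

/-- The homogeneous ideal of a subset of projective space. -/
noncomputable def homogeneousIdealOf (V : Set (P3 ℂ)) : Ideal EntryPoly :=
  Ideal.span (vanishingPolys V)

lemma isHomogeneous_homogeneousIdealOf (V : Set (P3 ℂ)) :
    (homogeneousIdealOf V).IsHomogeneous (homogeneousSubmodule (Fin 2 × Fin 2) ℂ) :=
  Ideal.homogeneous_span _ _ fun _ hf => hf.1

lemma mem_homogeneousIdealOf {V : Set (P3 ℂ)} {f : EntryPoly} (hf : f ∈ homogeneousPolys) :
    f ∈ homogeneousIdealOf V ↔ f ∈ vanishingPolys V := by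
  refine ⟨fun h => mem_vanishingPolys.2 ⟨hf, fun A hA hAV => ?_⟩, fun h => Ideal.subset_span h⟩
  have hle : homogeneousIdealOf V ≤ RingHom.ker (eval fun ij : Fin 2 × Fin 2 => A ij.1 ij.2) :=
    Ideal.span_le.2 fun g hg => (mem_vanishingPolys.1 hg).2 A hA hAV
  exact hle h

/-- The homogeneous ideal of an irreducible subvariety is prime. -/
lemma isPrime_homogeneousIdealOf {W : Set (P3 ℂ)} (hW : IsIrredSubvariety W) :
    (homogeneousIdealOf W).IsPrime := by
  obtain ⟨-, ⟨x, hx⟩, hirr⟩ := hW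
  refine (isHomogeneous_homogeneousIdealOf W).isPrime_of_homogeneous_mem_or_mem ?_ ?_
  · intro htop
    have h1 : (1 : EntryPoly) ∈ homogeneousIdealOf W := htop ▸ Submodule.mem_top
    rw [mem_homogeneousIdealOf ⟨0, isHomogeneous_one _ _⟩, mem_vanishingPolys] at h1
    induction x using Projectivization.ind with
    | h A hA => simpa using h1.2 A hA hx
  · intro f g hf hg hfg
    change f ∈ homogeneousPolys at hf
    change g ∈ homogeneousPolys at hg
    have hfg' : f * g ∈ homogeneousPolys := by
      obtain ⟨d, hd⟩ := hf
      obtain ⟨e, he⟩ := hg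
      exact ⟨_, hd.mul he⟩
    rw [mem_homogeneousIdealOf hfg', mem_vanishingPolys] at hfg
    have hcover : W ⊆ zeroSet (RingHom.id ℂ) {f} ∪ zeroSet (RingHom.id ℂ) {g} := by
      intro y hy
      induction y using Projectivization.ind with
      | h A hA =>
        have h2 := hfg.2 A hA hy
        rw [map_mul, mul_eq_zero] at h2
        refine h2.imp (fun h3 => ?_) (fun h3 => ?_)
        · refine (mem_zeroSet_mk_complex (Set.singleton_subset_iff.2 hf) hA).2 ?_
          rintro _ rfl; exact h3
        · refine (mem_zeroSet_mk_complex (Set.singleton_subset_iff.2 hg) hA).2 ?_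
          rintro _ rfl; exact h3
    rw [mem_homogeneousIdealOf hf, mem_homogeneousIdealOf hg]
    exact (hirr _ _ ⟨_, Set.singleton_subset_iff.2 hf, rfl⟩
      ⟨_, Set.singleton_subset_iff.2 hg, rfl⟩ hcover).imp (fun h => ⟨hf, h⟩) (fun h => ⟨hg, h⟩)

/-- The projective zero set of an ideal, cut out by its homogeneous elements. -/
def projZeroSet (I : Ideal EntryPoly) : Set (P3 ℂ) :=
  zeroSet (RingHom.id ℂ) {f | f ∈ I ∧ f ∈ homogeneousPolys}

lemma mk_mem_projZeroSet {I : Ideal EntryPoly} {A : Mat ℂ} {hA : A ≠ 0} :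
    Projectivization.mk ℂ A hA ∈ projZeroSet I ↔
      ∀ f ∈ I, f ∈ homogeneousPolys → eval (fun ij => A ij.1 ij.2) f = 0 := by
  rw [projZeroSet, mem_zeroSet_mk_complex (fun f hf => hf.2)]
  exact ⟨fun h f hf hf' => h f ⟨hf, hf'⟩, fun h f hf => h f hf.1 hf.2⟩

/-- Projective Nullstellensatz: a homogeneous polynomial that vanishes on the nonempty zero set of
a prime ideal lies in this ideal. -/
lemma mem_of_vanishes_on_projZeroSet {𝔭 : Ideal EntryPoly} [𝔭.IsPrime]
    (hne : (projZeroSet 𝔭).Nonempty) {f : EntryPoly} (hf : f ∈ vanishingPolys (projZeroSet 𝔭)) :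
    f ∈ 𝔭 := by
  rw [← IsPrime.vanishingIdeal_zeroLocus (K := ℂ) 𝔭]
  rw [mem_vanishingPolys] at hf
  obtain ⟨⟨d, hd⟩, hfV⟩ := hf
  intro x hx
  rw [MvPolynomial.aeval_eq_eval]
  by_cases hx0 : x = 0
  · -- at the vertex of the cone a nonconstant form vanishes, and a constant form that vanishes on
    -- a nonempty set is zero
    subst hx0
    obtain ⟨y, hy⟩ := hne
    induction y using Projectivization.ind with
    | h A hA =>
      have h1 := hfV A hA hy
      have h2 := hd.eval₂_smul (RingHom.id ℂ) 0 (fun ij : Fin 2 × Fin 2 => A ij.1 ij.2)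
      change eval _ f = _ * eval _ f at h2
      rw [h1, mul_zero] at h2
      simp only [zero_mul] at h2
      exact h2
  · let A : Mat ℂ := Matrix.of fun i j => x (i, j)
    have hent : (fun ij : Fin 2 × Fin 2 => A ij.1 ij.2) = x := rfl
    have hA : A ≠ 0 := by
      intro h0
      apply hx0
      rw [← hent, h0]
      rfl
    have h3 := hfV A hA (mk_mem_projZeroSet.2 fun g hg _ => by
      rw [hent, ← MvPolynomial.aeval_eq_eval]
      exact hx g hg)
    rwa [hent] at h3

/-- Through every point `[B]` of a variety without components inside the quadric there passes a
component, given by a prime ideal that does not contain the determinant. -/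
lemma exists_prime_through {V : Set (P3 ℂ)} (hV : IsSubvariety V)
    (hVQ : ∀ W, IsIrredComponent V W → ¬ W ⊆ quadric) {B : Mat ℂ} {hB : B ≠ 0}
    (hBV : Projectivization.mk ℂ B hB ∈ V) :
    ∃ 𝔭 : Ideal EntryPoly, 𝔭.IsPrime ∧ (∀ f ∈ vanishingPolys V, f ∈ 𝔭) ∧
      (∀ f ∈ 𝔭, eval (fun ij => B ij.1 ij.2) f = 0) ∧ detPoly ∉ 𝔭 := by
  let m : Ideal EntryPoly := RingHom.ker (eval fun ij : Fin 2 × Fin 2 => B ij.1 ij.2)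
  have : m.IsPrime := RingHom.ker_isPrime _
  have hIm : homogeneousIdealOf V ≤ m :=
    Ideal.span_le.2 fun g hg => (mem_vanishingPolys.1 hg).2 B hB hBV
  obtain ⟨𝔭, hmin, h𝔭m⟩ := Ideal.exists_minimalPrimes_le hIm
  have h𝔭 : 𝔭.IsPrime := hmin.1.1
  have hI𝔭 : homogeneousIdealOf V ≤ 𝔭 := hmin.1.2
  have hBW : Projectivization.mk ℂ B hB ∈ projZeroSet 𝔭 :=
    mk_mem_projZeroSet.2 fun f hf _ => h𝔭m hf
  have hWV : projZeroSet 𝔭 ⊆ V := by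
    intro x hx
    rw [← zeroSet_vanishingPolys hV]
    exact fun f hf => hx f ⟨hI𝔭 (Ideal.subset_span hf), hf.1⟩
  have hWsub : IsSubvariety (projZeroSet 𝔭) := ⟨_, fun f hf => hf.2, rfl⟩
  have hnull : ∀ f ∈ vanishingPolys (projZeroSet 𝔭), f ∈ 𝔭 := fun f hf =>
    mem_of_vanishes_on_projZeroSet ⟨_, hBW⟩ hf
  have hirr : IsIrredSubvariety (projZeroSet 𝔭) := by
    refine ⟨hWsub, ⟨_, hBW⟩, ?_⟩
    rintro _ _ ⟨F₁, hF₁, rfl⟩ ⟨F₂, hF₂, rfl⟩ hcov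
    by_contra! hcon
    -- a form in each `F i` that does not vanish on the whole zero set of `𝔭`
    have hsep : ∀ F : Set EntryPoly, F ⊆ homogeneousPolys →
        ¬ projZeroSet 𝔭 ⊆ zeroSet (RingHom.id ℂ) F → ∃ f ∈ F, f ∉ 𝔭 := by
      intro F hF hnot
      by_contra! hall
      exact hnot fun x hx f hf => hx f ⟨hall f hf, hF hf⟩
    obtain ⟨f, hf, hf𝔭⟩ := hsep F₁ hF₁ hcon.1
    obtain ⟨g, hg, hg𝔭⟩ := hsep F₂ hF₂ hcon.2
    have hfg : f * g ∈ 𝔭 := by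
      refine hnull _ (mem_vanishingPolys.2 ⟨?_, fun A hA hAW => ?_⟩)
      · obtain ⟨d, hd⟩ := hF₁ hf
        obtain ⟨e, he⟩ := hF₂ hg
        exact ⟨_, hd.mul he⟩
      · rw [map_mul, mul_eq_zero]
        exact (hcov hAW).imp (fun h => h f hf A hA rfl) (fun h => h g hg A hA rfl)
    exact (h𝔭.mem_or_mem hfg).elim hf𝔭 hg𝔭
  have hcomp : IsIrredComponent V (projZeroSet 𝔭) := by
    refine ⟨⟨hirr, hWV⟩, fun W' hW' hle => ?_⟩
    obtain ⟨hW'irr, hW'V⟩ := hW'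
    have hprime := isPrime_homogeneousIdealOf hW'irr
    have h1 : homogeneousIdealOf V ≤ homogeneousIdealOf W' :=
      Ideal.span_mono (vanishingPolys_anti hW'V)
    have h2 : homogeneousIdealOf W' ≤ 𝔭 :=
      Ideal.span_le.2 fun f hf => hnull f (vanishingPolys_anti hle hf)
    have h3 : 𝔭 ≤ homogeneousIdealOf W' := hmin.2 ⟨hprime, h1⟩ h2
    intro x hx f hf
    exact ((mem_homogeneousIdealOf hf.2).1 (h3 hf.1)).2 hx f rfl
  refine ⟨𝔭, h𝔭, fun f hf => hI𝔭 (Ideal.subset_span hf), fun f hf => h𝔭m hf, fun hdet => ?_⟩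
  refine hVQ _ hcomp fun x hx => ?_
  induction x using Projectivization.ind with
  | h A hA =>
    rw [mk_mem_quadric, ← eval_detPoly]
    exact mk_mem_projZeroSet.1 hx _ hdet detPoly_mem

end Components

/-! ### Explicit polar decomposition of `2 × 2` matrices -/

section Polar

/-- The squared Frobenius norm. -/
noncomputable def frobSq (A : Mat ℂ) : ℝ := ∑ i, ∑ j, ‖A i j‖ ^ 2

/-- The matrix `(det A / |det A|) (A^c)^*`. If `A = P U` is the polar decomposition then this is
`P^c U`, that is, `A` with its singular values exchanged. -/
noncomputable def swapSV (A : Mat ℂ) : Mat ℂ := (A.det / ‖A.det‖) • A.adjugateᴴ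

/-- The larger singular value of a `2 × 2` matrix. -/
noncomputable def sv₁ (A : Mat ℂ) : ℝ :=
  (√(frobSq A + 2 * ‖A.det‖) + √(frobSq A - 2 * ‖A.det‖)) / 2

/-- The smaller singular value of a `2 × 2` matrix. -/
noncomputable def sv₂ (A : Mat ℂ) : ℝ :=
  (√(frobSq A + 2 * ‖A.det‖) - √(frobSq A - 2 * ‖A.det‖)) / 2

lemma two_norm_det_le_frobSq (A : Mat ℂ) : 2 * ‖A.det‖ ≤ frobSq A := by
  rw [Matrix.det_fin_two, frobSq]
  simp only [Fin.sum_univ_two]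
  have h1 := norm_sub_le (A 0 0 * A 1 1) (A 0 1 * A 1 0)
  rw [norm_mul, norm_mul] at h1
  nlinarith [sq_nonneg (‖A 0 0‖ - ‖A 1 1‖), sq_nonneg (‖A 0 1‖ - ‖A 1 0‖)]

lemma frobSq_nonneg (A : Mat ℂ) : 0 ≤ frobSq A :=
  Finset.sum_nonneg fun _ _ => Finset.sum_nonneg fun _ _ => sq_nonneg _

lemma frobSq_pos {A : Mat ℂ} (hA : A ≠ 0) : 0 < frobSq A := by
  refine lt_of_le_of_ne (frobSq_nonneg A) fun h => hA ?_
  rw [frobSq, eq_comm, Finset.sum_eq_zero_iff_of_nonneg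
    (fun _ _ => Finset.sum_nonneg fun _ _ => sq_nonneg _)] at h
  ext i j
  have h1 := h i (Finset.mem_univ i)
  rw [Finset.sum_eq_zero_iff_of_nonneg (fun _ _ => sq_nonneg _)] at h1
  simpa using h1 j (Finset.mem_univ j)

lemma sv₁_add_sv₂ (A : Mat ℂ) : sv₁ A + sv₂ A = √(frobSq A + 2 * ‖A.det‖) := by
  unfold sv₁ sv₂; ring

lemma sv₁_mul_sv₂ (A : Mat ℂ) : sv₁ A * sv₂ A = ‖A.det‖ := by
  have h1 := Real.sq_sqrt (add_nonneg (frobSq_nonneg A) (mul_nonneg zero_le_two (norm_nonneg A.det)))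
  have h2 := Real.sq_sqrt (sub_nonneg.2 (two_norm_det_le_frobSq A))
  unfold sv₁ sv₂
  linear_combination (h1 - h2) / 4

lemma sv₁_pos {A : Mat ℂ} (hA : A ≠ 0) : 0 < sv₁ A := by
  have h := frobSq_pos hA
  unfold sv₁
  have : 0 < √(frobSq A + 2 * ‖A.det‖) := Real.sqrt_pos.2 (by positivity)
  positivity

lemma sv₂_le_sv₁ (A : Mat ℂ) : sv₂ A ≤ sv₁ A := by
  unfold sv₁ sv₂
  linarith [Real.sqrt_nonneg (frobSq A - 2 * ‖A.det‖)]

lemma sv₂_pos {A : Mat ℂ} (hA : A.det ≠ 0) : 0 < sv₂ A := by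
  have hA0 : A ≠ 0 := by rintro rfl; simp at hA
  have h := sv₁_mul_sv₂ A
  have h1 := norm_pos_iff.2 hA
  rw [← h] at h1
  exact (pos_iff_pos_of_mul_pos h1).1 (sv₁_pos hA0)

lemma frobSq_smul (c : ℂ) (A : Mat ℂ) : frobSq (c • A) = ‖c‖ ^ 2 * frobSq A := by
  simp [frobSq, Fin.sum_univ_two, mul_pow]; ring

lemma sv₁_smul (c : ℂ) (A : Mat ℂ) : sv₁ (c • A) = ‖c‖ * sv₁ A := by
  unfold sv₁
  rw [frobSq_smul, Matrix.det_smul, Fintype.card_fin, norm_mul, norm_pow,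
    show ‖c‖ ^ 2 * frobSq A + 2 * (‖c‖ ^ 2 * ‖A.det‖) = ‖c‖ ^ 2 * (frobSq A + 2 * ‖A.det‖) by ring,
    show ‖c‖ ^ 2 * frobSq A - 2 * (‖c‖ ^ 2 * ‖A.det‖) = ‖c‖ ^ 2 * (frobSq A - 2 * ‖A.det‖) by ring,
    Real.sqrt_mul (sq_nonneg _), Real.sqrt_mul (sq_nonneg _), Real.sqrt_sq (norm_nonneg c)]
  ring

lemma continuous_sv₁ : Continuous sv₁ := by
  unfold sv₁ frobSq
  fun_prop

open scoped ComplexOrder in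
lemma posSemidef_polarP (A : Mat ℂ) : (polarP A).PosSemidef := by
  have hH : (polarP A).IsHermitian := isSelfAdjoint_polarP A
  refine hH.posSemidef_iff_eigenvalues_nonneg.2 fun i => spectrum_polarP_nonneg A ?_
  rw [hH.spectrum_real_eq_range_eigenvalues]
  exact ⟨i, rfl⟩

open scoped ComplexOrder in
lemma det_polarP (A : Mat ℂ) : (polarP A).det = ‖A.det‖ := by
  have h0 := (posSemidef_polarP A).det_nonneg
  obtain ⟨r, hr, hr'⟩ : ∃ r : ℝ, 0 ≤ r ∧ (r : ℂ) = (polarP A).det :=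
    RCLike.nonneg_iff_exists_ofReal.1 h0
  have h2 := congrArg Matrix.det (polarP_mul_self A)
  rw [Matrix.det_mul, Matrix.det_mul, Matrix.det_conjTranspose, Complex.star_def,
    Complex.mul_conj, Complex.normSq_eq_norm_sq, ← hr'] at h2
  have h3 : r * r = ‖A.det‖ ^ 2 := by exact_mod_cast h2
  have h4 : r = ‖A.det‖ := by nlinarith [norm_nonneg A.det, sq_nonneg (r - ‖A.det‖)]
  rw [← hr', h4]

open scoped ComplexOrder in
lemma trace_polarP (A : Mat ℂ) : (polarP A).trace = ((sv₁ A + sv₂ A : ℝ) : ℂ) := by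
  have h0 := (posSemidef_polarP A).trace_nonneg
  obtain ⟨r, hr, hr'⟩ : ∃ r : ℝ, 0 ≤ r ∧ (r : ℂ) = (polarP A).trace :=
    RCLike.nonneg_iff_exists_ofReal.1 h0
  have h1 : (A * Aᴴ).trace = (frobSq A : ℂ) := by
    simp only [Matrix.trace_fin_two, Matrix.mul_apply, Fin.sum_univ_two, Matrix.conjTranspose_apply,
      Complex.star_def, Complex.mul_conj, Complex.normSq_eq_norm_sq, frobSq]
    push_cast
    ring
  have h2 : (polarP A * polarP A).trace = (polarP A).trace ^ 2 - 2 * (polarP A).det := by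
    simp only [Matrix.trace_fin_two, Matrix.mul_apply, Fin.sum_univ_two, Matrix.det_fin_two]
    ring
  rw [polarP_mul_self, h1, det_polarP, ← hr'] at h2
  have h3 : r ^ 2 = frobSq A + 2 * ‖A.det‖ := by
    have : (frobSq A : ℂ) = ((r ^ 2 - 2 * ‖A.det‖ : ℝ) : ℂ) := by
      rw [h2]; push_cast; ring
    have := Complex.ofReal_injective this
    linarith
  rw [← hr', sv₁_add_sv₂, ← h3, Real.sqrt_sq hr]

lemma eq_sv_of_mem_spectrum_polarP {A : Mat ℂ} {s : ℝ} (hs : s ∈ spectrum ℝ (polarP A)) :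
    s = sv₁ A ∨ s = sv₂ A := by
  have h1 : (algebraMap ℝ (Mat ℂ) s - polarP A).det = 0 := by
    by_contra h
    exact hs ((Matrix.isUnit_iff_isUnit_det _).2 (isUnit_iff_ne_zero.2 h))
  have h2 : (algebraMap ℝ (Mat ℂ) s - polarP A).det =
      s ^ 2 - s * (polarP A).trace + (polarP A).det := by
    rw [IsScalarTower.algebraMap_apply ℝ ℂ (Mat ℂ)]
    simp [Matrix.det_fin_two, Matrix.trace_fin_two, Matrix.algebraMap_matrix_apply]
    ring
  rw [h1, trace_polarP, det_polarP, ← sv₁_mul_sv₂] at h2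
  have h3 : (s - sv₁ A) * (s - sv₂ A) = 0 := by
    have : ((s - sv₁ A) * (s - sv₂ A) : ℂ) = 0 := by
      rw [eq_comm] at h2
      push_cast at h2
      linear_combination h2
    exact_mod_cast this
  rcases mul_eq_zero.1 h3 with h | h
  · exact Or.inl (sub_eq_zero.1 h)
  · exact Or.inr (sub_eq_zero.1 h)

lemma polarP_mul_polarU {A : Mat ℂ} (hA : A.det ≠ 0) : polarP A * polarU A = A := by
  have hP := (Matrix.isUnit_iff_isUnit_det _).1 (isUnit_polarP hA)
  rw [polarU, ← Matrix.mul_assoc, Matrix.mul_nonsing_inv _ hP, Matrix.one_mul]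

lemma conjTranspose_adjugate_polarU {A : Mat ℂ} (hA : A.det ≠ 0) :
    (polarU A).adjugateᴴ = star (polarU A).det • polarU A := by
  have hU := polarU_mem hA
  have h1 : (polarU A).adjugate = (polarU A).det • (polarU A)ᴴ := by
    calc (polarU A).adjugate = (polarU A).adjugate * (polarU A * (polarU A)ᴴ) := by
          rw [← Matrix.star_eq_conjTranspose, Matrix.mem_unitaryGroup_iff.1 hU, Matrix.mul_one]
      _ = (polarU A).det • (polarU A)ᴴ := by
          rw [← Matrix.mul_assoc, Matrix.adjugate_mul, Matrix.smul_mul, Matrix.one_mul]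
  rw [h1, Matrix.conjTranspose_smul, Matrix.conjTranspose_conjTranspose]

/-- The matrix `A + P^c U = (P + P^c) U` is a multiple of `U`, as `P + P^c` is the scalar `tr P`. -/
lemma trace_smul_polarU {A : Mat ℂ} (hA : A.det ≠ 0) :
    ((sv₁ A + sv₂ A : ℝ) : ℂ) • polarU A = A + swapSV A := by
  have hA' : (‖A.det‖ : ℂ) ≠ 0 := by simpa using hA
  have hadjP : (polarP A).adjugate = ((sv₁ A + sv₂ A : ℝ) : ℂ) • 1 - polarP A := by
    rw [← trace_polarP]
    ext i j
    fin_cases i <;> fin_cases j <;> simp [Matrix.adjugate_fin_two, Matrix.trace_fin_two]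
  have hdet : A.det = ‖A.det‖ * (polarU A).det := by
    conv_lhs => rw [← polarP_mul_polarU hA, Matrix.det_mul, det_polarP]
  have hunit : (polarU A).det * star (polarU A).det = 1 := by
    rw [← Matrix.det_conjTranspose, ← Matrix.det_mul, ← Matrix.star_eq_conjTranspose,
      Matrix.mem_unitaryGroup_iff.1 (polarU_mem hA), Matrix.det_one]
  have hadj : A.adjugateᴴ = star (polarU A).det • ((polarP A).adjugate * polarU A) := by
    conv_lhs => rw [← polarP_mul_polarU hA, Matrix.adjugate_mul_distrib,
      Matrix.conjTranspose_mul, conjTranspose_adjugate_polarU hA]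
    have hH : ((polarP A).adjugate)ᴴ = (polarP A).adjugate := by
      rw [Matrix.adjugate_conjTranspose]
      congr 1
      exact isSelfAdjoint_polarP A
    rw [hH, Matrix.mul_smul]
  have hδ : A.det / ‖A.det‖ = (polarU A).det := by
    rw [div_eq_iff hA', mul_comm]; exact hdet
  rw [swapSV, hδ, hadj, smul_smul, hunit, one_smul, hadjP, Matrix.sub_mul, polarP_mul_polarU hA,
    Matrix.smul_mul, Matrix.one_mul, add_sub_cancel]

/-- Explicit form of `P ^ h U` as a combination of `A` and of `A` with exchanged singular values.
If the singular values coincide then the last denominator and its coefficient vanish. -/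
lemma polarPow_mul_polarU (h : ℝ) {A : Mat ℂ} (hA : A.det ≠ 0) :
    polarPow h A * polarU A =
      ((sv₁ A ^ h + sv₂ A ^ h) / (2 * (sv₁ A + sv₂ A))) • (A + swapSV A) +
      ((sv₁ A ^ h - sv₂ A ^ h) / (2 * (sv₁ A - sv₂ A))) • (A - swapSV A) := by
  set a := (sv₁ A ^ h + sv₂ A ^ h) / (2 * (sv₁ A + sv₂ A)) with ha
  set b := (sv₁ A ^ h - sv₂ A ^ h) / (2 * (sv₁ A - sv₂ A)) with hb
  have hA0 : A ≠ 0 := by rintro rfl; simp at hA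
  have hpos : 0 < sv₁ A + sv₂ A := add_pos (sv₁_pos hA0) (sv₂_pos hA)
  have ha' : a * (sv₁ A + sv₂ A) = (sv₁ A ^ h + sv₂ A ^ h) / 2 := by
    rw [ha]; field_simp
  have hb' : b * (sv₁ A - sv₂ A) = (sv₁ A ^ h - sv₂ A ^ h) / 2 := by
    by_cases hs : sv₁ A - sv₂ A = 0
    · rw [hs, sub_eq_zero.1 hs]; simp
    · rw [hb]; field_simp
  have hcfc : polarPow h A = (a * (sv₁ A + sv₂ A) - b * (sv₁ A + sv₂ A)) • (1 : Mat ℂ) +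
      (2 * b) • polarP A := by
    have hsa := isSelfAdjoint_polarP A
    have h1 : polarPow h A = cfc (fun x : ℝ =>
        (a * (sv₁ A + sv₂ A) - b * (sv₁ A + sv₂ A)) + (2 * b) * x) (polarP A) := by
      refine cfc_congr fun x hx => ?_
      rcases eq_sv_of_mem_spectrum_polarP hx with rfl | rfl
      · linear_combination -ha' - hb'
      · linear_combination -ha' + hb'
    rw [h1, cfc_add _ _ _ (contOn_spectrum _ _) (contOn_spectrum _ _), cfc_const _ _ hsa,
      cfc_const_mul_id _ _ hsa, Algebra.algebraMap_eq_smul_one]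
  have hT := trace_smul_polarU hA
  rw [Complex.coe_smul] at hT
  rw [hcfc, Matrix.add_mul, Matrix.smul_mul, Matrix.smul_mul, Matrix.one_mul, polarP_mul_polarU hA,
    ← sub_mul, ← smul_smul, hT]
  module

end Polar

/-! ### The topology of projective space and limits of `R_{1 / log t}` -/

section PhaseLimit

lemma classOf_eq_mk {A : Mat ℂ} (hA : A ≠ 0) : classOf A = Projectivization.mk ℂ A hA :=
  dif_neg hA

lemma classOf_smul {c : ℂ} (hc : c ≠ 0) (A : Mat ℂ) : classOf (c • A) = classOf A := by
  by_cases hA : A = 0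
  · rw [hA, smul_zero]
  · rw [classOf_eq_mk hA, classOf_eq_mk (smul_ne_zero hc hA), Projectivization.mk_eq_mk_iff']
    exact ⟨c, rfl⟩

lemma tendsto_classOf {ι : Type*} {l : Filter ι} {M : ι → Mat ℂ} {M₀ : Mat ℂ}
    (hM : Tendsto M l (𝓝 M₀)) (h₀ : M₀ ≠ 0) :
    Tendsto (fun t => classOf (M t)) l (𝓝 (classOf M₀)) := by
  have hopen : IsOpen {A : Mat ℂ | A ≠ 0} := isOpen_ne
  have hcont : ContinuousOn classOf {A : Mat ℂ | A ≠ 0} := by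
    rw [continuousOn_iff_continuous_domRestrict]
    have h1 : Continuous (fun A : {A : Mat ℂ // A ≠ 0} => Projectivization.mk ℂ A.1 A.2) :=
      continuous_coinduced_rng
    refine h1.congr fun A => ?_
    exact (classOf_eq_mk A.2).symm
  exact (hcont.continuousAt (hopen.mem_nhds h₀)).tendsto.comp hM

/-- The rank-one projector `a a^* / |a|²` onto the line spanned by the vector of matrix entries. -/
noncomputable def lineProjector : P3 ℂ → (Fin 2 × Fin 2 → Fin 2 × Fin 2 → ℂ) :=
  Projectivization.lift
    (fun A p q => A.1 p.1 p.2 * star (A.1 q.1 q.2) / frobSq A.1) (by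
      rintro ⟨_, hA⟩ ⟨B, hB⟩ c rfl
      have hc : c ≠ 0 := by rintro rfl; simp at hA
      have hB' : (frobSq B : ℂ) ≠ 0 := Complex.ofReal_ne_zero.2 (frobSq_pos hB).ne'
      have hc' : (‖c‖ : ℂ) ≠ 0 := by simpa using hc
      funext p q
      have h1 : c * star c = (‖c‖ : ℂ) ^ 2 := by
        rw [Complex.star_def, Complex.mul_conj, Complex.normSq_eq_norm_sq]; push_cast; rfl
      simp only [Matrix.smul_apply, smul_eq_mul, star_mul', frobSq_smul]
      push_cast
      rw [div_eq_div_iff (by positivity) hB']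
      linear_combination (B p.1 p.2 * star (B q.1 q.2) * frobSq B) * h1)

lemma lineProjector_injective : Function.Injective lineProjector := by
  intro x y hxy
  induction x using Projectivization.ind with
  | h A hA =>
  induction y using Projectivization.ind with
  | h B hB =>
  simp only [lineProjector, Projectivization.lift_mk] at hxy
  obtain ⟨i, j, hij⟩ : ∃ i j, A i j ≠ 0 := by
    by_contra! h
    exact hA (by ext i j; exact h i j)
  have hA' : (frobSq A : ℂ) ≠ 0 := Complex.ofReal_ne_zero.2 (frobSq_pos hA).ne'
  have hB' : (frobSq B : ℂ) ≠ 0 := Complex.ofReal_ne_zero.2 (frobSq_pos hB).ne'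
  have hs : star (A i j) ≠ 0 := star_ne_zero.2 hij
  rw [Projectivization.mk_eq_mk_iff']
  refine ⟨frobSq A * star (B i j) / (frobSq B * star (A i j)), ?_⟩
  ext k l
  have h := congrFun (congrFun hxy (k, l)) (i, j)
  simp only at h
  rw [div_eq_div_iff hA' hB'] at h
  rw [Matrix.smul_apply, smul_eq_mul, div_mul_eq_mul_div, div_eq_iff (mul_ne_zero hB' hs)]
  linear_combination -h

lemma continuous_frobSq : Continuous frobSq := by
  unfold frobSq
  fun_prop

lemma continuous_lineProjector : Continuous lineProjector := by
  refine continuous_coinduced_dom.2 ?_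
  refine continuous_pi fun p => continuous_pi fun q => ?_
  change Continuous fun A : {A : Mat ℂ // A ≠ 0} =>
    A.1 p.1 p.2 * star (A.1 q.1 q.2) / (frobSq A.1 : ℂ)
  have hent : ∀ p : Fin 2 × Fin 2, Continuous fun A : {A : Mat ℂ // A ≠ 0} => A.1 p.1 p.2 :=
    fun p => continuous_subtype_val.matrix_elem p.1 p.2
  refine Continuous.div ((hent p).mul (hent q).star)
    (Complex.continuous_ofReal.comp (continuous_frobSq.comp continuous_subtype_val)) fun A => ?_
  exact Complex.ofReal_ne_zero.2 (frobSq_pos A.2).ne'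

instance : T2Space (P3 ℂ) := T2Space.of_injective_continuous lineProjector_injective
  continuous_lineProjector

lemma powMap_classOf_of_det_eq_zero (h : ℝ) {A : Mat ℂ} (hA : A ≠ 0) (hd : A.det = 0) :
    powMap h (classOf A) = classOf A := by
  rw [classOf_eq_mk hA]
  simp [powMap, hd]

lemma powMap_classOf (h : ℝ) {A : Mat ℂ} (hd : A.det ≠ 0) :
    powMap h (classOf A) = classOf (polarPow h A * polarU A) := by
  have hA : A ≠ 0 := by rintro rfl; simp at hd
  rw [classOf_eq_mk hA, classOf_eq_mk (polarPow_mul_polarU_ne_zero h hd)]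
  simp [powMap, hd]

/-- If `f t ~ c t ^ α` then `f t ^ (1 / log t) → e ^ α`. -/
lemma tendsto_rpow_inv_log {f : ℝ → ℝ} {α c : ℝ} (hc : 0 < c)
    (hf : Tendsto (fun t : ℝ => t ^ (-α) * f t) atTop (𝓝 c)) :
    Tendsto (fun t : ℝ => f t ^ (Real.log t)⁻¹) atTop (𝓝 (Real.exp α)) := by
  have h1 : Tendsto (fun t : ℝ => Real.log (t ^ (-α) * f t) / Real.log t) atTop (𝓝 0) :=
    (hf.log hc.ne').div_atTop Real.tendsto_log_atTop
  have h2 : Tendsto (fun t : ℝ => Real.exp (α + Real.log (t ^ (-α) * f t) / Real.log t)) atTop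
      (𝓝 (Real.exp α)) := by
    have := (tendsto_const_nhds (x := α)).add h1
    rw [add_zero] at this
    exact (Real.continuous_exp.tendsto _).comp this
  refine h2.congr' ?_
  filter_upwards [hf.eventually (lt_mem_nhds hc), eventually_gt_atTop 1] with t ht ht1
  have ht0 : 0 < t := by linarith
  have hpow : 0 < t ^ (-α) := Real.rpow_pos_of_pos ht0 _
  have hft : 0 < f t := (pos_iff_pos_of_mul_pos ht).1 hpow
  have hlog : Real.log t ≠ 0 := (Real.log_pos ht1).ne'
  rw [Real.rpow_def_of_pos hft, Real.log_mul hpow.ne' hft.ne', Real.log_rpow ht0]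
  congr 1
  field_simp
  ring

/-- The difference quotient of `x ^ h` is small for small `h`, by Bernoulli's inequality. -/
lemma rpow_sub_rpow_div_le {x y h : ℝ} (hy : 0 < y) (hxy : y ≤ x) (h0 : 0 ≤ h) (h1 : h ≤ 1) :
    0 ≤ (x ^ h - y ^ h) / (x - y) ∧ (x ^ h - y ^ h) / (x - y) ≤ h * y ^ h / y := by
  have hx : 0 < x := hy.trans_le hxy
  have hyh : 0 < y ^ h := Real.rpow_pos_of_pos hy h
  refine ⟨div_nonneg (sub_nonneg.2 (Real.rpow_le_rpow hy.le hxy h0)) (sub_nonneg.2 hxy), ?_⟩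
  rcases hxy.eq_or_lt with rfl | hlt
  · rw [sub_self, zero_div]
    positivity
  · have hr : -1 ≤ x / y - 1 := by
      have : 0 < x / y := by positivity
      linarith
    have hB := rpow_one_add_le_one_add_mul_self hr h0 h1
    rw [add_sub_cancel, Real.div_rpow hx.le hy.le, div_le_iff₀ hyh] at hB
    rw [div_le_iff₀ (sub_pos.2 hlt)]
    have : h * y ^ h / y * (x - y) = h * (x / y - 1) * y ^ h := by field_simp
    rw [this]
    linarith

/-- If `A(t) ~ B t ^ α` and `det A(t) ~ d t ^ k` then `R_{1 / log t} [A(t)]` converges to the class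
of `e ^ α B + e ^ (k - α) (d / |d|) (B^c)^*`. -/
lemma tendsto_powMap {A : ℝ → Mat ℂ} {α k : ℝ} {B : Mat ℂ} {d : ℂ} (hB : B ≠ 0) (hd : d ≠ 0)
    (hA : Tendsto (fun t : ℝ => ((t ^ (-α) : ℝ) : ℂ) • A t) atTop (𝓝 B))
    (hdet : Tendsto (fun t : ℝ => ((t ^ (-k) : ℝ) : ℂ) * (A t).det) atTop (𝓝 d))
    (hk : k ≤ 2 * α)
    (hM : Real.exp α • B + Real.exp (k - α) • ((d / ‖d‖) • B.adjugateᴴ) ≠ 0) :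
    Tendsto (fun t : ℝ => powMap (Real.log t)⁻¹ (classOf (A t))) atTop
      (𝓝 (classOf (Real.exp α • B + Real.exp (k - α) • ((d / ‖d‖) • B.adjugateᴴ)))) := by
  set σ₀ := sv₁ B with hσ₀
  have hσ₀pos : 0 < σ₀ := sv₁_pos hB
  have hpos : ∀ᶠ t : ℝ in atTop, 0 < t := eventually_gt_atTop 0
  have hdet_ne : ∀ᶠ t in atTop, (A t).det ≠ 0 := by
    filter_upwards [hdet.eventually_ne hd] with t ht h0
    exact ht (by rw [h0, mul_zero])
  -- asymptotics of the singular values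
  have hσ : Tendsto (fun t : ℝ => t ^ (-α) * sv₁ (A t)) atTop (𝓝 σ₀) := by
    refine ((continuous_sv₁.tendsto B).comp hA).congr' ?_
    filter_upwards [hpos] with t ht
    rw [Function.comp_apply, sv₁_smul, Complex.norm_real, Real.norm_eq_abs,
      abs_of_pos (Real.rpow_pos_of_pos ht _)]
  have hnd : Tendsto (fun t : ℝ => t ^ (-k) * ‖(A t).det‖) atTop (𝓝 ‖d‖) := by
    refine hdet.norm.congr' ?_
    filter_upwards [hpos] with t ht
    rw [norm_mul, Complex.norm_real, Real.norm_eq_abs, abs_of_pos (Real.rpow_pos_of_pos ht _)]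
  have hsv₂ : Tendsto (fun t : ℝ => t ^ (-(k - α)) * sv₂ (A t)) atTop (𝓝 (‖d‖ / σ₀)) := by
    refine (hnd.div hσ hσ₀pos.ne').congr' ?_
    filter_upwards [hpos, hσ.eventually_ne hσ₀pos.ne'] with t ht hne
    have h1 : t ^ (-(k - α)) * t ^ (-α) = t ^ (-k) := by
      rw [← Real.rpow_add ht]; congr 1; ring
    rw [Pi.div_apply, div_eq_iff hne, ← sv₁_mul_sv₂, ← h1]
    ring
  have hp₁ := tendsto_rpow_inv_log hσ₀pos hσ
  have hp₂ := tendsto_rpow_inv_log (div_pos (norm_pos_iff.2 hd) hσ₀pos) hsv₂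
  have hh : Tendsto (fun t : ℝ => (Real.log t)⁻¹) atTop (𝓝 0) :=
    Real.tendsto_log_atTop.inv_tendsto_atTop
  obtain ⟨τ₀, hτ₀, hτ, hcase⟩ : ∃ τ₀ : ℝ, 0 ≤ τ₀ ∧
      Tendsto (fun t : ℝ => t ^ (-α) * sv₂ (A t)) atTop (𝓝 τ₀) ∧
      ((k < 2 * α ∧ τ₀ = 0) ∨ (k = 2 * α ∧ 0 < τ₀)) := by
    rcases hk.lt_or_eq with hlt | heq
    · refine ⟨0, le_rfl, ?_, Or.inl ⟨hlt, rfl⟩⟩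
      have h0 : Tendsto (fun t : ℝ => t ^ (-(2 * α - k))) atTop (𝓝 0) :=
        tendsto_rpow_neg_atTop (by linarith)
      have := h0.mul hsv₂
      rw [zero_mul] at this
      refine this.congr' ?_
      filter_upwards [hpos] with t ht
      rw [← mul_assoc, ← Real.rpow_add ht]
      congr 2; ring
    · refine ⟨‖d‖ / σ₀, by positivity, ?_, Or.inr ⟨heq, div_pos (norm_pos_iff.2 hd) hσ₀pos⟩⟩
      rwa [show k - α = α by rw [heq]; ring] at hsv₂
  -- the two coefficients of the explicit polar decomposition, after division by `t ^ α`
  have ha : Tendsto (fun t : ℝ => (sv₁ (A t) ^ (Real.log t)⁻¹ + sv₂ (A t) ^ (Real.log t)⁻¹) /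
      (2 * (t ^ (-α) * sv₁ (A t) + t ^ (-α) * sv₂ (A t)))) atTop
      (𝓝 ((Real.exp α + Real.exp (k - α)) / (2 * (σ₀ + τ₀)))) :=
    (hp₁.add hp₂).div ((hσ.add hτ).const_mul 2) (by positivity)
  have hb : Tendsto (fun t : ℝ => (sv₁ (A t) ^ (Real.log t)⁻¹ - sv₂ (A t) ^ (Real.log t)⁻¹) /
      (2 * (t ^ (-α) * sv₁ (A t) - t ^ (-α) * sv₂ (A t)))) atTop
      (𝓝 ((Real.exp α - Real.exp (k - α)) / (2 * (σ₀ + τ₀)))) := by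
    rcases hcase with ⟨-, h0⟩ | ⟨heq, hτpos⟩
    · subst h0
      have := (hp₁.sub hp₂).div ((hσ.sub hτ).const_mul 2) (by
        rw [sub_zero]; positivity)
      rw [sub_zero] at this
      rw [add_zero]
      exact this
    · rw [show k - α = α by rw [heq]; ring, sub_self, zero_div]
      rw [show k - α = α by rw [heq]; ring] at hp₂
      have hup : Tendsto (fun t : ℝ => (Real.log t)⁻¹ * sv₂ (A t) ^ (Real.log t)⁻¹ /
          (2 * (t ^ (-α) * sv₂ (A t)))) atTop (𝓝 0) := by
        have := (hh.mul hp₂).div (hτ.const_mul 2) (by positivity)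
        rw [zero_mul, zero_div] at this
        exact this
      have hbound : ∀ᶠ t : ℝ in atTop, 0 ≤ (sv₁ (A t) ^ (Real.log t)⁻¹ -
          sv₂ (A t) ^ (Real.log t)⁻¹) / (2 * (t ^ (-α) * sv₁ (A t) - t ^ (-α) * sv₂ (A t))) ∧
          (sv₁ (A t) ^ (Real.log t)⁻¹ - sv₂ (A t) ^ (Real.log t)⁻¹) /
          (2 * (t ^ (-α) * sv₁ (A t) - t ^ (-α) * sv₂ (A t))) ≤
          (Real.log t)⁻¹ * sv₂ (A t) ^ (Real.log t)⁻¹ / (2 * (t ^ (-α) * sv₂ (A t))) := by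
        filter_upwards [hpos, hdet_ne, hh.eventually (ge_mem_nhds zero_lt_one),
          Real.tendsto_log_atTop.eventually_ge_atTop 0] with t ht hdt hle hlog
        have hs₂ := sv₂_pos hdt
        obtain ⟨h1, h2⟩ := rpow_sub_rpow_div_le hs₂ (sv₂_le_sv₁ (A t)) (inv_nonneg.2 hlog) hle
        have hc : 0 < t ^ (-α) := Real.rpow_pos_of_pos ht _
        have e1 : ∀ x : ℝ, x / (2 * (t ^ (-α) * sv₁ (A t) - t ^ (-α) * sv₂ (A t))) =
            x / (sv₁ (A t) - sv₂ (A t)) * (1 / (2 * t ^ (-α))) := by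
          intro x
          rw [div_mul_div_comm, mul_one]
          congr 1
          ring
        have e2 : ∀ x : ℝ, x / (2 * (t ^ (-α) * sv₂ (A t))) =
            x / sv₂ (A t) * (1 / (2 * t ^ (-α))) := by
          intro x
          rw [div_mul_div_comm, mul_one]
          congr 1
          ring
        rw [e1, e2]
        exact ⟨mul_nonneg h1 (by positivity), mul_le_mul_of_nonneg_right h2 (by positivity)⟩
      exact tendsto_of_tendsto_of_tendsto_of_le_of_le' tendsto_const_nhds hup
        (hbound.mono fun t h => h.1) (hbound.mono fun t h => h.2)
  -- the matrix with exchanged singular values, divided by `t ^ α`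
  have hswap : Tendsto (fun t : ℝ => ((t ^ (-α) : ℝ) : ℂ) • swapSV (A t)) atTop
      (𝓝 ((d / ‖d‖) • B.adjugateᴴ)) := by
    have h1 : Tendsto (fun t : ℝ => (((t ^ (-k) : ℝ) : ℂ) * (A t).det) /
        (‖((t ^ (-k) : ℝ) : ℂ) * (A t).det‖ : ℂ)) atTop (𝓝 (d / ‖d‖)) :=
      hdet.div ((Complex.continuous_ofReal.tendsto _).comp hdet.norm) (by simpa using hd)
    have h2 : Tendsto (fun t : ℝ => (((t ^ (-α) : ℝ) : ℂ) • A t).adjugateᴴ) atTop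
        (𝓝 B.adjugateᴴ) := by
      have hc : Continuous fun M : Mat ℂ => M.adjugateᴴ :=
        (continuous_id.matrix_adjugate).matrix_conjTranspose
      exact (hc.tendsto B).comp hA
    refine (h1.smul h2).congr' ?_
    filter_upwards [hpos] with t ht
    have hkpos : 0 < t ^ (-k) := Real.rpow_pos_of_pos ht _
    have hkne : ((t ^ (-k) : ℝ) : ℂ) ≠ 0 := Complex.ofReal_ne_zero.2 hkpos.ne'
    rw [swapSV, norm_mul, Complex.norm_real, Real.norm_eq_abs, abs_of_pos hkpos,
      Complex.ofReal_mul, mul_div_mul_left _ _ hkne, Matrix.adjugate_smul,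
      Matrix.conjTranspose_smul]
    simp only [Fintype.card_fin, Nat.add_one_sub_one, pow_one, Complex.star_def,
      Complex.conj_ofReal]
    rw [smul_comm]
  have hlim := (ha.smul (hA.add hswap)).add (hb.smul (hA.sub hswap))
  have hσne : ((σ₀ + τ₀ : ℝ) : ℂ)⁻¹ ≠ 0 :=
    inv_ne_zero (Complex.ofReal_ne_zero.2 (by positivity))
  have hval : ((Real.exp α + Real.exp (k - α)) / (2 * (σ₀ + τ₀))) • (B + (d / ‖d‖) • B.adjugateᴴ) +
      ((Real.exp α - Real.exp (k - α)) / (2 * (σ₀ + τ₀))) • (B - (d / ‖d‖) • B.adjugateᴴ) =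
      ((σ₀ + τ₀ : ℝ) : ℂ)⁻¹ • (Real.exp α • B + Real.exp (k - α) • ((d / ‖d‖) • B.adjugateᴴ)) := by
    have hne : σ₀ + τ₀ ≠ 0 := by positivity
    rw [← Complex.ofReal_inv, Complex.coe_smul]
    generalize (d / ‖d‖) • B.adjugateᴴ = C
    match_scalars <;> field_simp <;> ring
  rw [hval] at hlim
  have hfin := tendsto_classOf hlim (smul_ne_zero hσne hM)
  rw [classOf_smul hσne] at hfin
  refine hfin.congr' ?_
  filter_upwards [hpos, hdet_ne] with t ht hdt
  have hc : 0 < t ^ (-α) := Real.rpow_pos_of_pos ht _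
  rw [powMap_classOf _ hdt, polarPow_mul_polarU _ hdt]
  congr 1
  rw [Complex.coe_smul, Complex.coe_smul, ← smul_add, ← smul_sub, smul_smul, smul_smul]
  congr 2
  · rw [div_mul_eq_mul_div, ← mul_add, mul_left_comm, mul_comm _ (t ^ (-α)),
      mul_div_mul_left _ _ hc.ne']
  · rw [div_mul_eq_mul_div, ← mul_sub, mul_left_comm, mul_comm _ (t ^ (-α)),
      mul_div_mul_left _ _ hc.ne']

/-- If `A(t) ~ B t ^ α` is singular for large `t` then `R_{1 / log t} [A(t)]` converges to `[B]`. -/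
lemma tendsto_powMap_of_det_eq_zero {A : ℝ → Mat ℂ} {α : ℝ} {B : Mat ℂ} (hB : B ≠ 0)
    (hA : Tendsto (fun t : ℝ => ((t ^ (-α) : ℝ) : ℂ) • A t) atTop (𝓝 B))
    (hdet : ∀ᶠ t in atTop, (A t).det = 0) :
    Tendsto (fun t : ℝ => powMap (Real.log t)⁻¹ (classOf (A t))) atTop (𝓝 (classOf B)) := by
  refine (tendsto_classOf hA hB).congr' ?_
  filter_upwards [hdet, hA.eventually_ne hB, eventually_gt_atTop 0] with t ht hne hpos
  have hne' : A t ≠ 0 := by intro h; exact hne (by rw [h, smul_zero])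
  rw [powMap_classOf_of_det_eq_zero _ hne' ht]
  exact classOf_smul (Complex.ofReal_ne_zero.2 (Real.rpow_pos_of_pos hpos _).ne') _

end PhaseLimit

/-! ### Convergent Hahn series: evaluation is multiplicative and governed by the leading term -/

section HahnEvaluation

/-- `f = c t ^ α + o(t ^ α)`, where `c = 0` is allowed. -/
def LeadsWith (f : KK) (α : ℝ) (c : ℂ) : Prop :=
  f.coeff (-α) = c ∧ ∀ β > α, f.coeff (-β) = 0

lemma LeadsWith.coeff_eq_zero {f : KK} {α : ℝ} {c : ℂ} (h : LeadsWith f α c) {γ : ℝ}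
    (hγ : γ < -α) : f.coeff γ = 0 := by
  have := h.2 (-γ) (by linarith)
  rwa [neg_neg] at this

lemma LeadsWith.mul {f g : KK} {α β : ℝ} {c d : ℂ} (hf : LeadsWith f α c) (hg : LeadsWith g β d) :
    LeadsWith (f * g) (α + β) (c * d) := by
  have key : ∀ i j : ℝ, f.coeff i * g.coeff j ≠ 0 → -α ≤ i ∧ -β ≤ j := by
    intro i j hij
    constructor
    · by_contra! h
      exact hij (by rw [hf.coeff_eq_zero h, zero_mul])
    · by_contra! h
      exact hij (by rw [hg.coeff_eq_zero h, mul_zero])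
  constructor
  · rw [HahnSeries.coeff_mul, Finset.sum_eq_single ((-α, -β) : ℝ × ℝ)]
    · rw [hf.1, hg.1]
    · rintro ⟨i, j⟩ hmem hne
      by_contra h
      obtain ⟨h1, h2⟩ := key i j h
      have h3 : i + j = -(α + β) := (Finset.mem_antidiagonal.1 hmem).2.2
      exact hne (Prod.ext (by simp only; linarith) (by simp only; linarith))
    · intro hmem
      by_contra h
      refine hmem (Finset.mem_antidiagonal.2 ⟨?_, ?_, by simp only; ring⟩)
      · exact left_ne_zero_of_mul h
      · exact right_ne_zero_of_mul h
  · intro γ hγ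
    rw [HahnSeries.coeff_mul]
    refine Finset.sum_eq_zero ?_
    rintro ⟨i, j⟩ hmem
    by_contra h
    obtain ⟨h1, h2⟩ := key i j h
    have h3 : i + j = -γ := (Finset.mem_antidiagonal.1 hmem).2.2
    linarith

lemma LeadsWith.add {f g : KK} {α : ℝ} {c d : ℂ} (hf : LeadsWith f α c) (hg : LeadsWith g α d) :
    LeadsWith (f + g) α (c + d) :=
  ⟨by rw [HahnSeries.coeff_add, hf.1, hg.1], fun β hβ => by
    rw [HahnSeries.coeff_add, hf.2 β hβ, hg.2 β hβ, add_zero]⟩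

lemma LeadsWith.sub {f g : KK} {α : ℝ} {c d : ℂ} (hf : LeadsWith f α c) (hg : LeadsWith g α d) :
    LeadsWith (f - g) α (c - d) :=
  ⟨by rw [HahnSeries.coeff_sub, hf.1, hg.1], fun β hβ => by
    rw [HahnSeries.coeff_sub, hf.2 β hβ, hg.2 β hβ, sub_zero]⟩

lemma leadsWith_zero (α : ℝ) : LeadsWith 0 α 0 := ⟨rfl, fun _ _ => rfl⟩

lemma LeadsWith.sum {ι : Type*} (s : Finset ι) {f : ι → KK} {α : ℝ} {c : ι → ℂ}
    (h : ∀ i ∈ s, LeadsWith (f i) α (c i)) : LeadsWith (∑ i ∈ s, f i) α (∑ i ∈ s, c i) := by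
  classical
  induction s using Finset.induction_on with
  | empty => exact leadsWith_zero α
  | insert i s hi ih =>
    rw [Finset.sum_insert hi, Finset.sum_insert hi]
    exact (h i (Finset.mem_insert_self i s)).add
      (ih fun j hj => h j (Finset.mem_insert_of_mem hj))

lemma leadsWith_C (c : ℂ) : LeadsWith (HahnSeries.C c) 0 c := by
  constructor
  · simp
  · intro β hβ
    rw [HahnSeries.C_apply, HahnSeries.coeff_single_of_ne (by linarith)]

lemma leadsWith_single (α : ℝ) (c : ℂ) : LeadsWith (HahnSeries.single (-α) c) α c :=
  ⟨HahnSeries.coeff_single_same _ _, fun β hβ =>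
    HahnSeries.coeff_single_of_ne (by intro h; linarith)⟩

lemma LeadsWith.of_lt {f : KK} {α β : ℝ} {c : ℂ} (h : LeadsWith f α c) (hlt : α < β) :
    LeadsWith f β 0 :=
  ⟨h.2 β hlt, fun γ hγ => h.2 γ (hlt.trans hγ)⟩

lemma LeadsWith.pow {f : KK} {α : ℝ} {c : ℂ} (h : LeadsWith f α c) (n : ℕ) :
    LeadsWith (f ^ n) (n * α) (c ^ n) := by
  induction n with
  | zero => simpa using leadsWith_C 1
  | succ n ih =>
    rw [pow_succ, pow_succ]
    have := ih.mul h
    rwa [show (n : ℝ) * α + α = ((n + 1 : ℕ) : ℝ) * α by push_cast; ring] at this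

lemma LeadsWith.prod {ι : Type*} (s : Finset ι) {f : ι → KK} {α : ι → ℝ} {c : ι → ℂ}
    (h : ∀ i ∈ s, LeadsWith (f i) (α i) (c i)) :
    LeadsWith (∏ i ∈ s, f i) (∑ i ∈ s, α i) (∏ i ∈ s, c i) := by
  classical
  induction s using Finset.induction_on with
  | empty => simpa using leadsWith_C 1
  | insert i s hi ih =>
    rw [Finset.prod_insert hi, Finset.prod_insert hi, Finset.sum_insert hi]
    exact (h i (Finset.mem_insert_self i s)).mul
      (ih fun j hj => h j (Finset.mem_insert_of_mem hj))

/-- The leading coefficient of the value of a form is the value at the leading coefficients. -/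
lemma LeadsWith.eval₂ {σ : Type*} {f : MvPolynomial σ ℂ} {n : ℕ} (hf : f.IsHomogeneous n)
    {x : σ → KK} {α : ℝ} {b : σ → ℂ} (h : ∀ i, LeadsWith (x i) α (b i)) :
    LeadsWith (MvPolynomial.eval₂ HahnSeries.C x f) (n * α) (MvPolynomial.eval b f) := by
  rw [MvPolynomial.eval₂_eq, MvPolynomial.eval_eq]
  refine LeadsWith.sum _ fun m hm => ?_
  have hd : ∑ i ∈ m.support, m i = n := by
    have h1 : m.degree = n := by
      rw [Finsupp.degree_eq_weight_one]
      exact hf (MvPolynomial.mem_support_iff.1 hm)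
    exact h1
  have h2 := (leadsWith_C (MvPolynomial.coeff m f)).mul
    (LeadsWith.prod m.support fun i _ => (h i).pow (m i))
  rwa [← Finset.sum_mul, ← Nat.cast_sum, hd, zero_add] at h2

lemma LeadsWith.ne_zero {f : KK} {α : ℝ} {c : ℂ} (h : LeadsWith f α c) (hc : c ≠ 0) : f ≠ 0 := by
  rintro rfl
  exact hc (by simpa using h.1.symm)

lemma LeadsWith.order_eq {f : KK} {α : ℝ} {c : ℂ} (h : LeadsWith f α c) (hc : c ≠ 0) :
    f.order = -α := by
  have h1 : f.order ≤ -α := HahnSeries.order_le_of_coeff_ne_zero (by rw [h.1]; exact hc)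
  refine le_antisymm h1 ?_
  by_contra! hlt
  exact h.ne_zero hc (HahnSeries.coeff_order_eq_zero.1 (h.coeff_eq_zero hlt))

lemma LeadsWith.leadingCoeff_eq {f : KK} {α : ℝ} {c : ℂ} (h : LeadsWith f α c) (hc : c ≠ 0) :
    f.leadingCoeff = c := by
  rw [HahnSeries.leadingCoeff_eq, h.order_eq hc, h.1]

lemma leadsWith_order (f : KK) : LeadsWith f (-f.order) f.leadingCoeff := by
  refine ⟨by rw [neg_neg, HahnSeries.leadingCoeff_eq], fun β hβ => ?_⟩
  exact HahnSeries.coeff_eq_zero_of_lt_order (by linarith)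

lemma LeadsWith.neg_order_le {f : KK} {α : ℝ} {c : ℂ} (h : LeadsWith f α c) (hf : f ≠ 0) :
    -f.order ≤ α := by
  by_contra! hlt
  exact hf (HahnSeries.coeff_order_eq_zero.1 (h.coeff_eq_zero (by linarith)))

lemma LeadsWith.neg_order_lt {f : KK} {α : ℝ} (h : LeadsWith f α 0) (hf : f ≠ 0) :
    -f.order < α := by
  refine lt_of_le_of_ne (h.neg_order_le hf) fun heq => ?_
  have h1 := h.1
  rw [← heq, neg_neg] at h1
  exact hf (HahnSeries.coeff_order_eq_zero.1 h1)

/-- A convergent series is asymptotic to its leading term. -/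
lemma LeadsWith.tendsto {f : KK} {α : ℝ} {c : ℂ} (h : LeadsWith f α c) (hf : IsConvergent f) :
    Tendsto (fun t : ℝ => ((t ^ (-α) : ℝ) : ℂ) * seriesEval f t) atTop (𝓝 c) := by
  obtain ⟨t₀, hsum, ht₀⟩ := (hf.and (eventually_ge_atTop 1)).exists
  have ht₀pos : 0 < t₀ := by linarith
  have hlim : ∀ γ : ℝ, Tendsto (fun t : ℝ => f.coeff γ * ((t ^ (-(γ + α)) : ℝ) : ℂ)) atTop
      (𝓝 (if γ = -α then c else 0)) := by
    intro γ
    split_ifs with hγ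
    · subst hγ
      rw [h.1]
      simp
    · rcases lt_or_gt_of_ne hγ with hlt | hgt
      · rw [h.coeff_eq_zero hlt]
        simp
      · have h1 : Tendsto (fun t : ℝ => ((t ^ (-(γ + α)) : ℝ) : ℂ)) atTop (𝓝 0) := by
          have := tendsto_rpow_neg_atTop (show 0 < γ + α by linarith)
          have h2 := (Complex.continuous_ofReal.tendsto 0).comp this
          rw [Complex.ofReal_zero] at h2
          exact h2
        simpa using h1.const_mul (f.coeff γ)
  have hbound : ∀ᶠ t : ℝ in atTop, ∀ γ : ℝ, ‖f.coeff γ * ((t ^ (-(γ + α)) : ℝ) : ℂ)‖ ≤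
      ‖((t₀ ^ (-α) : ℝ) : ℂ) * (f.coeff γ * ((t₀ ^ (-γ) : ℝ) : ℂ))‖ := by
    filter_upwards [eventually_ge_atTop t₀] with t ht γ
    have htpos : 0 < t := by linarith
    have e1 : ((t₀ ^ (-α) : ℝ) : ℂ) * (f.coeff γ * ((t₀ ^ (-γ) : ℝ) : ℂ)) =
        f.coeff γ * ((t₀ ^ (-(γ + α)) : ℝ) : ℂ) := by
      rw [neg_add, Real.rpow_add ht₀pos]; push_cast; ring
    rw [e1, norm_mul, norm_mul]
    by_cases hγ : γ < -α
    · rw [h.coeff_eq_zero hγ]; simp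
    · refine mul_le_mul_of_nonneg_left ?_ (norm_nonneg _)
      rw [Complex.norm_real, Complex.norm_real, Real.norm_eq_abs, Real.norm_eq_abs,
        abs_of_pos (Real.rpow_pos_of_pos htpos _), abs_of_pos (Real.rpow_pos_of_pos ht₀pos _)]
      exact Real.rpow_le_rpow_of_nonpos ht₀pos ht (by linarith)
  have hmain := tendsto_tsum_of_dominated_convergence
    ((hsum.mul_left ((t₀ ^ (-α) : ℝ) : ℂ)).norm) hlim hbound
  rw [tsum_ite_eq] at hmain
  refine hmain.congr' ?_
  filter_upwards [eventually_gt_atTop 0] with t ht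
  rw [seriesEval, ← tsum_mul_left]
  refine tsum_congr fun γ => ?_
  rw [neg_add, Real.rpow_add ht]
  push_cast
  ring

/-- The Cauchy product of two series that converge at `t` converges to the product of the sums. -/
lemma hasSum_mul_coeff {f g : KK} {t : ℝ} (ht : 0 < t)
    (hf : Summable fun γ : ℝ => f.coeff γ * ((t ^ (-γ) : ℝ) : ℂ))
    (hg : Summable fun γ : ℝ => g.coeff γ * ((t ^ (-γ) : ℝ) : ℂ)) :
    HasSum (fun γ : ℝ => (f * g).coeff γ * ((t ^ (-γ) : ℝ) : ℂ))
      (seriesEval f t * seriesEval g t) := by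
  have h0 := summable_mul_of_summable_norm hf.norm hg.norm
  have h1 := hf.hasSum.mul hg.hasSum h0
  have h2 := (Equiv.hasSum_iff (Equiv.sigmaFiberEquiv fun p : ℝ × ℝ => p.1 + p.2)).2 h1
  refine h2.sigma fun γ => ?_
  -- the terms of degree `γ` form a finite sum
  let s := Finset.antidiagonal f.isPWO_support g.isPWO_support γ
  let u : ℝ × ℝ → ℂ := fun p =>
    f.coeff p.1 * ((t ^ (-p.1) : ℝ) : ℂ) * (g.coeff p.2 * ((t ^ (-p.2) : ℝ) : ℂ))
  have hs : ∑ p ∈ s, u p = (f * g).coeff γ * ((t ^ (-γ) : ℝ) : ℂ) := by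
    rw [HahnSeries.coeff_mul, Finset.sum_mul]
    refine Finset.sum_congr rfl fun p hp => ?_
    have hp' : p.1 + p.2 = γ := (Finset.mem_antidiagonal.1 hp).2.2
    simp only [u]
    rw [← hp', neg_add, Real.rpow_add ht]
    push_cast
    ring
  rw [← hs]
  have h3 : HasSum ({p : ℝ × ℝ | p.1 + p.2 = γ}.indicator u) (∑ p ∈ s, u p) := by
    have h4 : ∑ p ∈ s, u p = ∑ p ∈ s, {p : ℝ × ℝ | p.1 + p.2 = γ}.indicator u p := by
      refine Finset.sum_congr rfl fun p hp => ?_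
      rw [Set.indicator_of_mem]
      exact (Finset.mem_antidiagonal.1 hp).2.2
    rw [h4]
    refine hasSum_sum_of_ne_finset_zero fun p hp => ?_
    by_cases hmem : p.1 + p.2 = γ
    · rw [Set.indicator_of_mem (by exact hmem)]
      by_contra hne
      refine hp (Finset.mem_antidiagonal.2 ⟨?_, ?_, hmem⟩)
      · exact left_ne_zero_of_mul (left_ne_zero_of_mul hne)
      · exact left_ne_zero_of_mul (right_ne_zero_of_mul hne)
    · exact Set.indicator_of_notMem (s := {p : ℝ × ℝ | p.1 + p.2 = γ}) hmem u
  exact hasSum_subtype_iff_indicator.2 h3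

lemma hasSum_sub_coeff {f g : KK} {t : ℝ} {a b : ℂ}
    (hf : HasSum (fun γ : ℝ => f.coeff γ * ((t ^ (-γ) : ℝ) : ℂ)) a)
    (hg : HasSum (fun γ : ℝ => g.coeff γ * ((t ^ (-γ) : ℝ) : ℂ)) b) :
    HasSum (fun γ : ℝ => (f - g).coeff γ * ((t ^ (-γ) : ℝ) : ℂ)) (a - b) := by
  simpa [sub_mul] using hf.sub hg

/-- The determinant of a matrix with convergent entries converges to the determinant of the value
of the matrix. -/
lemma eventually_hasSum_det {A : Mat KK} (hA : ∀ i j, IsConvergent (A i j)) :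
    ∀ᶠ t : ℝ in atTop, HasSum (fun γ : ℝ => A.det.coeff γ * ((t ^ (-γ) : ℝ) : ℂ))
      (A.map fun f => seriesEval f t).det := by
  filter_upwards [hA 0 0, hA 0 1, hA 1 0, hA 1 1, eventually_gt_atTop 0] with t h00 h01 h10 h11 ht
  rw [Matrix.det_fin_two, Matrix.det_fin_two]
  exact hasSum_sub_coeff (hasSum_mul_coeff ht h00 h11) (hasSum_mul_coeff ht h01 h10)

lemma isConvergent_det {A : Mat KK} (hA : ∀ i j, IsConvergent (A i j)) : IsConvergent A.det :=
  (eventually_hasSum_det hA).mono fun _ h => h.summable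

lemma eventually_seriesEval_det {A : Mat KK} (hA : ∀ i j, IsConvergent (A i j)) :
    ∀ᶠ t : ℝ in atTop, seriesEval A.det t = (A.map fun f => seriesEval f t).det :=
  (eventually_hasSum_det hA).mono fun _ h => h.tsum_eq

lemma isConvergent_of_finite_support {f : KK} (hf : f.support.Finite) : IsConvergent f :=
  Eventually.of_forall fun _ => summable_of_hasFiniteSupport <| hf.subset fun _ hγ =>
    left_ne_zero_of_mul hγ

lemma isConvergent_single (γ : ℝ) (c : ℂ) : IsConvergent (HahnSeries.single γ c) :=
  isConvergent_of_finite_support ((Set.finite_singleton γ).subset HahnSeries.support_single_subset)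

lemma IsConvergent.add {f g : KK} (hf : IsConvergent f) (hg : IsConvergent g) :
    IsConvergent (f + g) := by
  filter_upwards [hf, hg] with t h1 h2
  simpa [add_mul] using h1.add h2

/-- Every Hahn series is a square: the unit `1 + ε` has the square root `(1 + ε) ^ (1 / 2)`, given
by the binomial series. -/
lemma isSquare_hahnSeries (f : KK) : IsSquare f := by
  by_cases hf : f = 0
  · rw [hf]; exact IsSquare.zero
  have hlc : f.leadingCoeff ≠ 0 := HahnSeries.leadingCoeff_ne_zero.2 hf
  let ε : KK := HahnSeries.single (-f.order) (f.leadingCoeff)⁻¹ * f - 1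
  have hε : 0 < ε.orderTop := by
    have := HahnSeries.unit_aux f (inv_mul_cancel₀ hlc) (-f.order) (neg_add_cancel _)
    rwa [← HahnSeries.orderTop_neg, neg_sub] at this
  obtain ⟨c, hc⟩ := IsAlgClosed.exists_pow_nat_eq f.leadingCoeff two_pos
  let S : PowerSeries ℂ := PowerSeries.binomialSeries ℂ (1 / 2 : ℚ)
  have hS : S * S = 1 + PowerSeries.X := by
    rw [← PowerSeries.binomialSeries_add]
    have h := PowerSeries.binomialSeries_nat (R := ℚ) (A := ℂ) 1
    rw [pow_one] at h
    rw [← h]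
    norm_num
  have h1 : PowerSeries.heval ε S * PowerSeries.heval ε S = 1 + ε := by
    rw [← map_mul, hS, map_add, map_one, PowerSeries.heval_X ε hε]
  refine ⟨HahnSeries.single (f.order / 2) c * PowerSeries.heval ε S, ?_⟩
  rw [mul_mul_mul_comm, h1, HahnSeries.single_mul_single, ← pow_two c, hc, add_halves]
  simp only [ε]
  rw [add_sub_cancel, ← mul_assoc, HahnSeries.single_mul_single, mul_inv_cancel₀ hlc,
    add_neg_cancel, HahnSeries.single_zero_one, one_mul]

end HahnEvaluation

/-! ### The matrix valuation in terms of the leading term and the determinant -/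

section MatrixValuation

/-- A representative of the matrix valuation of a matrix with top order term `B t ^ α` and
determinant `D`. If `D = 0` then its leading coefficient is `0` and the second summand vanishes. -/
noncomputable def limitMatrix (α : ℝ) (B : Mat ℂ) (D : KK) : Mat ℂ :=
  Real.exp α • B +
    Real.exp (-D.order - α) • ((D.leadingCoeff / ‖D.leadingCoeff‖) • B.adjugateᴴ)

lemma limitMatrix_zero (α : ℝ) (B : Mat ℂ) : limitMatrix α B 0 = Real.exp α • B := by
  simp [limitMatrix]

/-- In the intermediate range the limit is a point of the cone over the circle bundle, at the
height that compares the growth of the matrix and of its determinant. The phase of the determinant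
is absorbed by the point `u B` of the circle over `[B]`. -/
lemma limitMatrix_eq_smul_coneMatrix (α : ℝ) (B : Mat ℂ) (D : KK) {u : ℂ} (hu : ‖u‖ = 1)
    (hud : u ^ 2 * (D.leadingCoeff / ‖D.leadingCoeff‖) = 1) :
    limitMatrix α B D = ((Real.exp (-D.order / 2) : ℂ) * u⁻¹) •
      coneMatrix (α + D.order / 2) (u • B) := by
  have hu0 : u ≠ 0 := by rintro rfl; simp at hu
  have hstar : star u = u⁻¹ := by
    rw [Complex.star_def, Complex.inv_def, Complex.normSq_eq_norm_sq, hu]; simp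
  have h1 : D.leadingCoeff / ‖D.leadingCoeff‖ = u⁻¹ * u⁻¹ := by
    rw [← mul_inv, ← pow_two]
    exact eq_inv_of_mul_eq_one_right hud
  have h2 : (u • B).adjugateᴴ = u⁻¹ • B.adjugateᴴ := by
    rw [Matrix.adjugate_smul, Matrix.conjTranspose_smul]
    simp only [Fintype.card_fin, Nat.add_one_sub_one, pow_one, hstar]
  rw [limitMatrix, coneMatrix, h1, h2, smul_add, ← Complex.coe_smul, ← Complex.coe_smul,
    ← Complex.coe_smul, ← Complex.coe_smul, smul_smul, smul_smul, smul_smul, smul_smul, smul_smul]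
  have e1 : Real.exp α = Real.exp (-D.order / 2) * Real.exp (α + D.order / 2) := by
    rw [← Real.exp_add]; congr 1; ring
  have e2 : Real.exp (-D.order - α) = Real.exp (-D.order / 2) * Real.exp (-(α + D.order / 2)) := by
    rw [← Real.exp_add]; congr 1; ring
  rw [e1, e2]
  push_cast
  congr 2
  · field_simp
  · ring

/-- A unit square root of the inverse phase of a nonzero complex number. -/
lemma exists_sq_mul_phase_eq_one {d : ℂ} (hd : d ≠ 0) :
    ∃ u : ℂ, ‖u‖ = 1 ∧ u ^ 2 * (d / ‖d‖) = 1 := by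
  have hd' : (‖d‖ : ℂ) ≠ 0 := by simpa using hd
  have hδ : d / ‖d‖ ≠ 0 := div_ne_zero hd hd'
  obtain ⟨u, hu⟩ := IsAlgClosed.exists_pow_nat_eq (d / ‖d‖)⁻¹ two_pos
  have h1 : u ^ 2 * (d / ‖d‖) = 1 := by rw [hu, inv_mul_cancel₀ hδ]
  refine ⟨u, ?_, h1⟩
  have h2 := congrArg norm hu
  rw [norm_pow, norm_inv, norm_div, Complex.norm_real, norm_norm, div_self (norm_ne_zero_iff.2 hd),
    inv_one] at h2
  exact (pow_eq_one_iff_of_nonneg (norm_nonneg u) two_ne_zero).1 h2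

lemma HasLeadingTerm.leadsWith {A : Mat KK} {α : ℝ} {B : Mat ℂ} (h : HasLeadingTerm A α B)
    (i j : Fin 2) : LeadsWith (A i j) α (B i j) := h.2 i j

lemma HasLeadingTerm.det {A : Mat KK} {α : ℝ} {B : Mat ℂ} (h : HasLeadingTerm A α B) :
    LeadsWith A.det (2 * α) B.det := by
  rw [Matrix.det_fin_two, Matrix.det_fin_two, two_mul]
  exact ((h.leadsWith 0 0).mul (h.leadsWith 1 1)).sub ((h.leadsWith 0 1).mul (h.leadsWith 1 0))

lemma HasLeadingTerm.ne_zero {A : Mat KK} {α : ℝ} {B : Mat ℂ} (h : HasLeadingTerm A α B) :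
    A ≠ 0 := by
  rintro rfl
  refine h.1 ?_
  ext i j
  exact ((h.leadsWith i j).1).symm

lemma HasLeadingTerm.smul {A : Mat KK} {α : ℝ} {B : Mat ℂ} (h : HasLeadingTerm A α B) {f : KK}
    (hf : f ≠ 0) : HasLeadingTerm (f • A) (-f.order + α) (f.leadingCoeff • B) :=
  ⟨smul_ne_zero (HahnSeries.leadingCoeff_ne_zero.2 hf) h.1, fun i j =>
    (leadsWith_order f).mul (h.leadsWith i j)⟩

lemma HasLeadingTerm.unique {A : Mat KK} {α α' : ℝ} {B B' : Mat ℂ} (h : HasLeadingTerm A α B)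
    (h' : HasLeadingTerm A α' B') : α = α' ∧ B = B' := by
  have key : ∀ {α α' : ℝ} {B B' : Mat ℂ}, HasLeadingTerm A α B → HasLeadingTerm A α' B' →
      α' ≤ α := by
    intro α α' B B' h h'
    by_contra! hlt
    refine h'.1 ?_
    ext i j
    rw [← (h'.leadsWith i j).1]
    exact (h.leadsWith i j).2 _ hlt
  have hα : α = α' := le_antisymm (key h' h) (key h h')
  subst hα
  refine ⟨rfl, ?_⟩
  ext i j
  rw [← (h.leadsWith i j).1, (h'.leadsWith i j).1]

lemma exists_hasLeadingTerm {A : Mat KK} (hA : A ≠ 0) : ∃ α B, HasLeadingTerm A α B := by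
  classical
  let s : Finset (Fin 2 × Fin 2) := Finset.univ.filter fun p => A p.1 p.2 ≠ 0
  have hs : s.Nonempty := by
    by_contra hne
    rw [Finset.not_nonempty_iff_eq_empty] at hne
    refine hA ?_
    ext1 i j
    by_contra h
    exact Finset.notMem_empty (i, j) (hne ▸ Finset.mem_filter.2 ⟨Finset.mem_univ _, h⟩)
  obtain ⟨p, hp, hmin⟩ := s.exists_min_image (fun p => (A p.1 p.2).order) hs
  refine ⟨-(A p.1 p.2).order, Matrix.of fun i j => (A i j).coeff (A p.1 p.2).order, ?_, ?_⟩
  · intro h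
    have h1 := congrFun (congrFun h p.1) p.2
    exact (Finset.mem_filter.1 hp).2 (HahnSeries.coeff_order_eq_zero.1 h1)
  · intro i j
    rw [neg_neg]
    refine ⟨rfl, fun β hβ => ?_⟩
    by_cases h0 : A i j = 0
    · rw [h0, HahnSeries.coeff_zero]
    · have := hmin (i, j) (Finset.mem_filter.2 ⟨Finset.mem_univ _, h0⟩)
      exact HahnSeries.coeff_eq_zero_of_lt_order (by simp only at this; linarith)

lemma HasLeadingTerm.limitMatrix_eq_smul_polarU {A : Mat KK} {α : ℝ} {B : Mat ℂ} (h : HasLeadingTerm A α B)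
    (hB : B.det ≠ 0) :
    limitMatrix α B A.det = (Real.exp α * (sv₁ B + sv₂ B) : ℂ) • polarU B := by
  have h1 := h.det.order_eq hB
  have h2 := h.det.leadingCoeff_eq hB
  have h3 := trace_smul_polarU hB
  rw [← smul_smul, ← Complex.ofReal_add, h3, limitMatrix, h1, h2, swapSV, smul_add,
    Complex.coe_smul, Complex.coe_smul]
  congr 3
  ring

lemma HasLeadingTerm.limitMatrix_ne_zero {A : Mat KK} {α : ℝ} {B : Mat ℂ}
    (h : HasLeadingTerm A α B) : limitMatrix α B A.det ≠ 0 := by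
  by_cases hB : B.det = 0
  · by_cases hD : A.det = 0
    · rw [hD, limitMatrix_zero]
      exact smul_ne_zero (Real.exp_pos α).ne' h.1
    · obtain ⟨u, hu, hud⟩ := exists_sq_mul_phase_eq_one (HahnSeries.leadingCoeff_ne_zero.2 hD)
      have hu0 : u ≠ 0 := by rintro rfl; simp at hu
      rw [limitMatrix_eq_smul_coneMatrix α B _ hu hud]
      have h1 := (hB ▸ h.det).neg_order_lt hD
      refine smul_ne_zero (mul_ne_zero (Complex.ofReal_ne_zero.2 (Real.exp_pos _).ne')
        (inv_ne_zero hu0)) (coneMatrix_ne_zero (by linarith) (smul_ne_zero hu0 h.1))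
  · rw [h.limitMatrix_eq_smul_polarU hB]
    refine smul_ne_zero ?_ (polarU_ne_zero hB)
    have h1 := sv₁_pos h.1
    have h2 := sv₂_pos hB
    have h3 : Real.exp α * (sv₁ B + sv₂ B) ≠ 0 := by positivity
    exact_mod_cast h3

/-- The phase limit of a matrix with convergent entries. -/
lemma HasLeadingTerm.isPhaseLimit {A : Mat KK} {α : ℝ} {B : Mat ℂ} (h : HasLeadingTerm A α B)
    (hA : ∀ i j, IsConvergent (A i j)) : IsPhaseLimit A (classOf (limitMatrix α B A.det)) := by
  have hlim : Tendsto (fun t : ℝ => ((t ^ (-α) : ℝ) : ℂ) • A.map fun f => seriesEval f t) atTop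
      (𝓝 B) :=
    tendsto_pi_nhds.2 fun i => tendsto_pi_nhds.2 fun j => (h.leadsWith i j).tendsto (hA i j)
  have hdet := eventually_seriesEval_det hA
  by_cases hD : A.det = 0
  · rw [hD, limitMatrix_zero, ← Complex.coe_smul, classOf_smul
      (Complex.ofReal_ne_zero.2 (Real.exp_pos α).ne')]
    refine tendsto_powMap_of_det_eq_zero h.1 hlim ?_
    filter_upwards [hdet] with t ht
    rw [← ht, hD]
    simp [seriesEval]
  · have hd := HahnSeries.leadingCoeff_ne_zero.2 hD
    have hdlim : Tendsto (fun t : ℝ => ((t ^ (-(-A.det.order)) : ℝ) : ℂ) *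
        (A.map fun f => seriesEval f t).det) atTop (𝓝 A.det.leadingCoeff) := by
      refine ((leadsWith_order A.det).tendsto (isConvergent_det hA)).congr' ?_
      filter_upwards [hdet] with t ht
      rw [ht]
    exact tendsto_powMap h.1 hd hlim hdlim (h.det.neg_order_le hD) h.limitMatrix_ne_zero

lemma limitMatrix_smul (α : ℝ) (B : Mat ℂ) (D : KK) {f : KK} (hf : f ≠ 0) :
    classOf (limitMatrix (-f.order + α) (f.leadingCoeff • B) (f ^ 2 * D)) =
      classOf (limitMatrix α B D) := by
  have hc := HahnSeries.leadingCoeff_ne_zero.2 hf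
  have hc' : (‖f.leadingCoeff‖ : ℂ) ≠ 0 := by simpa using hc
  have hne : (Real.exp (-f.order) : ℂ) * f.leadingCoeff ≠ 0 :=
    mul_ne_zero (Complex.ofReal_ne_zero.2 (Real.exp_pos _).ne') hc
  rw [← classOf_smul hne (limitMatrix α B D)]
  congr 1
  by_cases hD : D = 0
  · rw [hD, mul_zero, limitMatrix_zero, limitMatrix_zero, ← Complex.coe_smul, ← Complex.coe_smul,
      smul_smul, smul_smul, Real.exp_add]
    push_cast
    congr 1
    ring
  · have h1 : (f ^ 2 * D).order = 2 * f.order + D.order := by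
      rw [HahnSeries.order_mul (pow_ne_zero 2 hf) hD, HahnSeries.order_pow, two_nsmul, two_mul]
    have h2 : (f ^ 2 * D).leadingCoeff = f.leadingCoeff ^ 2 * D.leadingCoeff := by
      rw [pow_two, HahnSeries.leadingCoeff_mul, HahnSeries.leadingCoeff_mul, pow_two]
    have h3 : star f.leadingCoeff = (‖f.leadingCoeff‖ : ℂ) ^ 2 / f.leadingCoeff := by
      rw [eq_div_iff hc, Complex.star_def, mul_comm, Complex.mul_conj, Complex.normSq_eq_norm_sq]
      push_cast; rfl
    have h4 : (f.leadingCoeff • B).adjugateᴴ = star f.leadingCoeff • B.adjugateᴴ := by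
      rw [Matrix.adjugate_smul, Matrix.conjTranspose_smul]
      simp only [Fintype.card_fin, Nat.add_one_sub_one, pow_one]
    have e1 : Real.exp (-(2 * f.order + D.order) - (-f.order + α)) =
        Real.exp (-f.order) * Real.exp (-D.order - α) := by
      rw [← Real.exp_add]; congr 1; ring
    rw [limitMatrix, limitMatrix, h1, h2, h4, h3, e1, Real.exp_add, norm_mul, norm_pow, smul_add,
      ← Complex.coe_smul, ← Complex.coe_smul, ← Complex.coe_smul, ← Complex.coe_smul,
      smul_smul, smul_smul, smul_smul, smul_smul, smul_smul, smul_smul]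
    push_cast
    congr 2
    · ring
    · field_simp

/-- A matrix with determinant `1` has a companion with convergent entries, with the same top order
term and the same determinant. -/
lemma HasLeadingTerm.exists_convergent {A : Mat KK} {α : ℝ} {B : Mat ℂ} (h : HasLeadingTerm A α B)
    (hdet : A.det = 1) :
    ∃ A' : Mat KK, A'.det = 1 ∧ HasLeadingTerm A' α B ∧ ∀ i j, IsConvergent (A' i j) := by
  have hone : LeadsWith (1 : KK) 0 1 := leadsWith_C 1
  have hlead := h.det
  rw [hdet] at hlead
  by_cases hB : B.det = 0
  · have hα : 0 < α := by
      have := (hB ▸ hlead).neg_order_lt one_ne_zero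
      rw [hone.order_eq one_ne_zero] at this
      linarith
    -- the correction `t ^ (-α) (B^c)^* / |B|²` has determinant zero and makes the determinant `1`
    have hN : (frobSq B : ℂ) ≠ 0 := Complex.ofReal_ne_zero.2 (frobSq_pos h.1).ne'
    let C : Mat ℂ := (frobSq B : ℂ)⁻¹ • B.adjugateᴴ
    refine ⟨Matrix.of fun i j => HahnSeries.single (-α) (B i j) + HahnSeries.single α (C i j),
      ?_, ⟨h.1, fun i j => ?_⟩, fun i j => ?_⟩
    · have e0 : B 0 0 * C 1 1 + C 0 0 * B 1 1 - B 0 1 * C 1 0 - C 0 1 * B 1 0 = 1 := by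
        have : B 0 0 * B.adjugateᴴ 1 1 + B.adjugateᴴ 0 0 * B 1 1 - B 0 1 * B.adjugateᴴ 1 0
            - B.adjugateᴴ 0 1 * B 1 0 = frobSq B := by
          simp only [Matrix.adjugate_fin_two, Matrix.conjTranspose_apply, Matrix.of_apply,
            Matrix.cons_val', Matrix.cons_val_zero, Matrix.cons_val_one, Matrix.cons_val_fin_one,
            Complex.star_def, map_neg, frobSq, Fin.sum_univ_two, ← Complex.normSq_eq_norm_sq]
          push_cast
          simp only [← Complex.mul_conj]
          ring
        simp only [C, Matrix.smul_apply, smul_eq_mul]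
        field_simp
        linear_combination this
      have e1 : B 0 0 * B 1 1 - B 0 1 * B 1 0 = 0 := by rw [← Matrix.det_fin_two, hB]
      have e2 : C 0 0 * C 1 1 - C 0 1 * C 1 0 = 0 := by
        rw [← Matrix.det_fin_two, Matrix.det_smul, Matrix.det_conjTranspose, Matrix.det_adjugate,
          hB]
        simp
      have e3 : (HahnSeries.single (-α) (B 0 0) + HahnSeries.single α (C 0 0)) *
          (HahnSeries.single (-α) (B 1 1) + HahnSeries.single α (C 1 1)) -
          (HahnSeries.single (-α) (B 0 1) + HahnSeries.single α (C 0 1)) *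
          (HahnSeries.single (-α) (B 1 0) + HahnSeries.single α (C 1 0)) =
          HahnSeries.single (-α + -α) (B 0 0 * B 1 1 - B 0 1 * B 1 0) +
          HahnSeries.single 0
            (B 0 0 * C 1 1 + C 0 0 * B 1 1 - B 0 1 * C 1 0 - C 0 1 * B 1 0) +
          HahnSeries.single (α + α) (C 0 0 * C 1 1 - C 0 1 * C 1 0) := by
        simp only [mul_add, add_mul, HahnSeries.single_mul_single, HahnSeries.single_add,
          HahnSeries.single_sub, neg_add_cancel, add_neg_cancel]
        ring
      rw [Matrix.det_fin_two]
      simp only [Matrix.of_apply]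
      rw [e3, e0, e1, e2]
      simp
    · have := (leadsWith_single α (B i j)).add ((leadsWith_single (-α) (C i j)).of_lt
        (show -α < α by linarith))
      rw [neg_neg, add_zero] at this
      exact this
    · exact (isConvergent_single _ _).add (isConvergent_single _ _)
  · have h1 := hlead.order_eq hB
    rw [hone.order_eq one_ne_zero] at h1
    have hα : α = 0 := by linarith
    subst hα
    have hB1 : B.det = 1 := by
      have := hlead.leadingCoeff_eq hB
      rw [hone.leadingCoeff_eq one_ne_zero] at this
      exact this.symm
    refine ⟨B.map HahnSeries.C, ?_, ⟨h.1, fun i j => leadsWith_C _⟩,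
      fun i j => isConvergent_single _ _⟩
    rw [← RingHom.mapMatrix_apply, ← RingHom.map_det, hB1, map_one]

/-- The matrix valuation is determined by the top order term and the determinant. -/
lemma HasLeadingTerm.isMatrixValuation_iff {A : Mat KK} {α : ℝ} {B : Mat ℂ}
    (h : HasLeadingTerm A α B) {x : P3 ℂ} :
    IsMatrixValuation (Projectivization.mk KK A h.ne_zero) x ↔
      x = classOf (limitMatrix α B A.det) := by
  constructor
  · rintro ⟨A₁, hA₁, A', α₁, B₁, he, hdet, h₁, h', hconv, hlim⟩
    obtain ⟨f, hf⟩ := (Projectivization.mk_eq_mk_iff' ..).1 he.symm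
    have hf0 : f ≠ 0 := by rintro rfl; exact hA₁ (hf.symm.trans (zero_smul KK A))
    subst hf
    obtain ⟨hα, hB⟩ := h₁.unique (h.smul hf0)
    have hx := tendsto_nhds_unique hlim (h'.isPhaseLimit hconv)
    rw [hx, hdet, hα, hB, Matrix.det_smul, Fintype.card_fin, limitMatrix_smul _ _ _ hf0]
  · rintro rfl
    by_cases hD : A.det = 0
    · have hB : B.det = 0 := by
        have := h.det.1
        rw [hD, HahnSeries.coeff_zero] at this
        exact this.symm
      have hdet' : (Matrix.of fun i j => HahnSeries.single (-α) (B i j) : Mat KK).det = 0 := by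
        rw [Matrix.det_fin_two] at hB ⊢
        simp only [Matrix.of_apply, HahnSeries.single_mul_single]
        rw [← HahnSeries.single_sub, hB, map_zero]
      have h' : HasLeadingTerm (Matrix.of fun i j => HahnSeries.single (-α) (B i j)) α B :=
        ⟨h.1, fun i j => leadsWith_single α (B i j)⟩
      have hconv : ∀ i j, IsConvergent
          ((Matrix.of fun i j => HahnSeries.single (-α) (B i j) : Mat KK) i j) :=
        fun i j => isConvergent_single _ _
      refine ⟨A, h.ne_zero, _, α, B, rfl, hdet'.trans hD.symm, h, h', hconv, ?_⟩
      have := h'.isPhaseLimit hconv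
      rwa [hdet', ← hD] at this
    · -- rescale the matrix so that its determinant becomes `1`
      obtain ⟨g, hg⟩ := isSquare_hahnSeries A.det
      have hg0 : g ≠ 0 := by rintro rfl; exact hD (by rw [hg, zero_mul])
      have hf0 : g⁻¹ ≠ 0 := inv_ne_zero hg0
      have hsm := h.smul hf0
      have hdet : (g⁻¹ • A).det = 1 := by
        rw [Matrix.det_smul, Fintype.card_fin, hg]
        field_simp
      obtain ⟨A', hA', h', hconv⟩ := hsm.exists_convergent hdet
      refine ⟨g⁻¹ • A, hsm.ne_zero, A', _, _, ?_, hA'.trans hdet.symm, hsm, h', hconv, ?_⟩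
      · rw [Projectivization.mk_eq_mk_iff']
        exact ⟨g, by rw [smul_smul, mul_inv_cancel₀ hg0, one_smul]⟩
      · have := h'.isPhaseLimit hconv
        rwa [hA', ← hdet, Matrix.det_smul, Fintype.card_fin, limitMatrix_smul _ _ _ hf0] at this

lemma existsUnique_isMatrixValuation (p : P3 KK) : ∃! x, IsMatrixValuation p x := by
  induction p using Projectivization.ind with
  | h A hA =>
    obtain ⟨α, B, h⟩ := exists_hasLeadingTerm hA
    exact ⟨_, h.isMatrixValuation_iff.2 rfl, fun y hy => h.isMatrixValuation_iff.1 hy⟩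

lemma HasLeadingTerm.VAL_eq {A : Mat KK} {α : ℝ} {B : Mat ℂ} (h : HasLeadingTerm A α B) :
    VAL (Projectivization.mk KK A h.ne_zero) = classOf (limitMatrix α B A.det) :=
  h.isMatrixValuation_iff.1 (Classical.epsilon_spec (existsUnique_isMatrixValuation _).exists)

end MatrixValuation

/-! ### The image of the matrix valuation -/

section Image

/-- The substitution of the monomial `u = ζ t ^ (-r)` with a real exponent into the power series in
`u`. -/
noncomputable def monomialSubst (ζ : ℂ) {r : ℝ} (hr : 0 < r) : PowerSeries ℂ →+* KK :=
  (HahnSeries.embDomainRingHom ((AddMonoidHom.mulRight r).comp (Nat.castAddMonoidHom ℝ))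
    (fun _ _ h => Nat.cast_injective (mul_right_cancel₀ hr.ne' h))
    (fun _ _ => (mul_le_mul_iff_left₀ hr).trans Nat.cast_le)).comp
  ((HahnSeries.toPowerSeries (R := ℂ)).symm.toRingHom.comp (PowerSeries.rescale ζ))

lemma coeff_monomialSubst (ζ : ℂ) {r : ℝ} (hr : 0 < r) (F : PowerSeries ℂ) (n : ℕ) :
    (monomialSubst ζ hr F).coeff (n * r) = ζ ^ n * PowerSeries.coeff n F := by
  rw [← PowerSeries.coeff_rescale, ← HahnSeries.coeff_toPowerSeries_symm]
  exact HahnSeries.embDomain_coeff (a := n)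

lemma coeff_monomialSubst_of_ne (ζ : ℂ) {r : ℝ} (hr : 0 < r) (F : PowerSeries ℂ) {γ : ℝ}
    (hγ : ∀ n : ℕ, (n : ℝ) * r ≠ γ) : (monomialSubst ζ hr F).coeff γ = 0 :=
  HahnSeries.embDomain_of_notMem_range (by rintro ⟨n, hn⟩; exact hγ n hn)

lemma monomialSubst_C (ζ : ℂ) {r : ℝ} (hr : 0 < r) (c : ℂ) :
    monomialSubst ζ hr (PowerSeries.C c) = HahnSeries.C c := by
  have h1 : HahnSeries.toPowerSeries.symm (PowerSeries.rescale ζ (PowerSeries.C c)) =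
      (HahnSeries.C c : HahnSeries ℕ ℂ) := by
    ext n
    rw [HahnSeries.coeff_toPowerSeries_symm, PowerSeries.coeff_rescale, PowerSeries.coeff_C,
      HahnSeries.C_apply, HahnSeries.coeff_single]
    split_ifs with h
    · simp [h]
    · simp
  change HahnSeries.embDomainRingHom _ _ _ (HahnSeries.toPowerSeries.symm
    (PowerSeries.rescale ζ (PowerSeries.C c))) = _
  rw [h1]
  exact HahnSeries.embDomainRingHom_C

lemma leadsWith_monomialSubst (ζ : ℂ) {r : ℝ} (hr : 0 < r) {F : PowerSeries ℂ} {m : ℕ}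
    (hF : ∀ i < m, PowerSeries.coeff i F = 0) :
    LeadsWith (monomialSubst ζ hr F) (-(m * r)) (ζ ^ m * PowerSeries.coeff m F) := by
  refine ⟨by rw [neg_neg, coeff_monomialSubst], fun β hβ => ?_⟩
  by_cases h : ∃ n : ℕ, (n : ℝ) * r = -β
  · obtain ⟨n, hn⟩ := h
    have hlt : (n : ℝ) < m := lt_of_mul_lt_mul_right (by linarith) hr.le
    rw [← hn, coeff_monomialSubst, hF n (by exact_mod_cast hlt), mul_zero]
  · exact coeff_monomialSubst_of_ne ζ hr F (not_exists.1 h)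

lemma mk_mem_pointsKK {V : Set (P3 ℂ)} {A : Mat KK} (hA : A ≠ 0) :
    Projectivization.mk KK A hA ∈ pointsKK V ↔
      ∀ f ∈ vanishingPolys V, MvPolynomial.eval₂ HahnSeries.C (fun ij => A ij.1 ij.2) f = 0 :=
  mem_zeroSet_mk _ (vanishingPolys_subset V) hA

/-- The leading coefficient of a `𝕂`-point of `V` is a point of `V`. -/
lemma HasLeadingTerm.mk_mem_of_mem_pointsKK {V : Set (P3 ℂ)} (hV : IsSubvariety V) {A : Mat KK}
    {α : ℝ} {B : Mat ℂ} (h : HasLeadingTerm A α B)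
    (hA : Projectivization.mk KK A h.ne_zero ∈ pointsKK V) : Projectivization.mk ℂ B h.1 ∈ V := by
  rw [mk_mem_pointsKK] at hA
  rw [← zeroSet_vanishingPolys hV, mem_zeroSet_mk_complex (vanishingPolys_subset V)]
  intro f hf
  obtain ⟨n, hn⟩ := vanishingPolys_subset V hf
  have h1 := (LeadsWith.eval₂ hn fun ij : Fin 2 × Fin 2 => h.leadsWith ij.1 ij.2).1
  rw [hA f hf, HahnSeries.coeff_zero] at h1
  exact h1.symm

lemma hasLeadingTerm_map_C {B : Mat ℂ} (hB : B ≠ 0) :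
    HasLeadingTerm (B.map HahnSeries.C) 0 B :=
  ⟨hB, fun _ _ => leadsWith_C _⟩

/-- A complex point of `V` is a constant `𝕂`-point. -/
lemma mk_map_C_mem_pointsKK {V : Set (P3 ℂ)} {B : Mat ℂ} (hB : B ≠ 0)
    (hBV : Projectivization.mk ℂ B hB ∈ V) :
    Projectivization.mk KK (B.map HahnSeries.C) (hasLeadingTerm_map_C hB).ne_zero ∈ pointsKK V := by
  rw [mk_mem_pointsKK]
  intro f hf
  have h1 := (mem_vanishingPolys.1 hf).2 B hB hBV
  have h2 := MvPolynomial.eval₂_comp_left (HahnSeries.C : ℂ →+* KK) (RingHom.id ℂ)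
    (fun ij : Fin 2 × Fin 2 => B ij.1 ij.2) f
  change HahnSeries.C (MvPolynomial.eval (fun ij : Fin 2 × Fin 2 => B ij.1 ij.2) f) = _ at h2
  rw [h1, map_zero, RingHom.comp_id] at h2
  exact h2.symm

lemma det_map_C (B : Mat ℂ) : (B.map (HahnSeries.C : ℂ →+* KK)).det = HahnSeries.C B.det := by
  rw [← RingHom.mapMatrix_apply, ← RingHom.map_det]

lemma vertex_toP3 {B : Mat ℂ} (hB : B ≠ 0) (hd : B.det ≠ 0)
    (hx : Projectivization.mk ℂ B hB ∉ quadric) :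
    (ConePoint.vertex (sphericalCoamoeba ⟨Projectivization.mk ℂ B hB, hx⟩)).toP3 =
      classOf (polarU B) := by
  rw [classOf_eq_mk (polarU_ne_zero hd)]
  simp [ConePoint.toP3, sphericalCoamoeba, unitaryClass, hd]

lemma inner_toP3 (α : Set.Ioi (0 : ℝ)) {B : Mat ℂ} (hB : B ≠ 0)
    (hs : Projectivization.mk ℝ B hB ∈ circleBundle) :
    (ConePoint.inner α ⟨Projectivization.mk ℝ B hB, hs⟩).toP3 = classOf (coneMatrix α B) := by
  rw [classOf_eq_mk (coneMatrix_ne_zero α.2 hB)]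
  rfl

lemma HasLeadingTerm.classOf_limitMatrix_of_det_ne_zero {A : Mat KK} {α : ℝ} {B : Mat ℂ}
    (h : HasLeadingTerm A α B) (hB : B.det ≠ 0) :
    classOf (limitMatrix α B A.det) = classOf (polarU B) := by
  have h1 := sv₁_pos h.1
  have h2 := sv₂_pos hB
  have h3 : Real.exp α * (sv₁ B + sv₂ B) ≠ 0 := by positivity
  rw [h.limitMatrix_eq_smul_polarU hB, classOf_smul (by exact_mod_cast h3)]

/-- Every point over `V ∩ Q` of the open cone is the valuation of some `𝕂`-point of `V`: a formal
arc in `V` through the point, not inside `Q`, reaches every height and every point of the circle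
after a substitution `u = ζ t ^ (-r)`. -/
lemma exists_pointsKK_VAL_eq_coneMatrix {V : Set (P3 ℂ)} (hV : IsSubvariety V)
    (hVQ : ∀ W, IsIrredComponent V W → ¬ W ⊆ quadric) {B : Mat ℂ} (hB : B ≠ 0)
    (hBV : Projectivization.mk ℂ B hB ∈ V) (hd : B.det = 0) {β : ℝ} (hβ : 0 < β) :
    ∃ p ∈ pointsKK V, VAL p = classOf (coneMatrix β B) := by
  obtain ⟨𝔭, h𝔭, hV𝔭, h𝔭B, hdet⟩ := exists_prime_through hV hVQ hBV
  obtain ⟨Φ, hΦ𝔭, hΦdet, hΦB⟩ := exists_arc 𝔭 _ h𝔭B hdet (by rw [eval_detPoly, hd])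
  -- order `m` and leading coefficient `c` of the determinant along the arc
  obtain ⟨m, hm, hlt⟩ : ∃ m, PowerSeries.coeff m (Φ detPoly) ≠ 0 ∧
      ∀ i < m, PowerSeries.coeff i (Φ detPoly) = 0 := by
    classical
    have h : ∃ m, PowerSeries.coeff m (Φ detPoly) ≠ 0 :=
      PowerSeries.exists_coeff_ne_zero_iff_ne_zero.2 hΦdet
    exact ⟨Nat.find h, Nat.find_spec h, fun i hi => not_not.1 (Nat.find_min h hi)⟩
  set c := PowerSeries.coeff m (Φ detPoly) with hc
  have hm0 : 0 < m := by
    rw [Nat.pos_iff_ne_zero]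
    rintro rfl
    refine hm ?_
    rw [hc, PowerSeries.coeff_zero_eq_constantCoeff_apply, hΦB, eval_detPoly, hd]
  -- `r` adjusts the height and `ζ` makes the leading coefficient of the determinant equal to `1`
  obtain ⟨ζ, hζ⟩ := IsAlgClosed.exists_pow_nat_eq c⁻¹ hm0
  have hr : 0 < 2 * β / m := by positivity
  let ψ : EntryPoly →+* KK := (monomialSubst ζ hr).comp Φ.toRingHom
  let A : Mat KK := Matrix.of fun i j => ψ (MvPolynomial.X (i, j))
  have hψ : ∀ f, MvPolynomial.eval₂ HahnSeries.C (fun ij => A ij.1 ij.2) f = ψ f := by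
    intro f
    have : MvPolynomial.eval₂Hom HahnSeries.C (fun ij : Fin 2 × Fin 2 => A ij.1 ij.2) = ψ := by
      refine MvPolynomial.ringHom_ext (fun a => ?_) fun ij => ?_
      · rw [MvPolynomial.eval₂Hom_C]
        change _ = monomialSubst ζ hr (Φ (MvPolynomial.C a))
        rw [← MvPolynomial.algebraMap_eq, AlgHom.commutes]
        exact (monomialSubst_C ζ hr a).symm
      · rw [MvPolynomial.eval₂Hom_X']
        rfl
    exact DFunLike.congr_fun this f
  have hlead : HasLeadingTerm A 0 B := by
    refine ⟨hB, fun i j => ?_⟩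
    have h1 := leadsWith_monomialSubst ζ hr (F := Φ (MvPolynomial.X (i, j))) (m := 0)
      (fun i hi => absurd hi (Nat.not_lt_zero i))
    rw [PowerSeries.coeff_zero_eq_constantCoeff_apply, hΦB, MvPolynomial.eval_X] at h1
    simp only [Nat.cast_zero, zero_mul, neg_zero, pow_zero, one_mul] at h1
    exact h1
  have hdetA : LeadsWith A.det (-(2 * β)) 1 := by
    have h1 := leadsWith_monomialSubst ζ hr hlt
    rw [hζ, inv_mul_cancel₀ hm, mul_div_cancel₀ _ (Nat.cast_ne_zero.2 hm0.ne')] at h1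
    rw [← eval₂_detPoly HahnSeries.C, hψ]
    exact h1
  refine ⟨Projectivization.mk KK A hlead.ne_zero, ?_, ?_⟩
  · rw [mk_mem_pointsKK]
    intro f hf
    rw [hψ]
    change monomialSubst ζ hr (Φ f) = 0
    rw [hΦ𝔭 f (hV𝔭 f hf), map_zero]
  · have hlc := hdetA.leadingCoeff_eq one_ne_zero
    have hord := hdetA.order_eq one_ne_zero
    rw [hlead.VAL_eq, limitMatrix_eq_smul_coneMatrix 0 B _ (u := 1) norm_one (by rw [hlc]; simp),
      classOf_smul (mul_ne_zero (Complex.ofReal_ne_zero.2 (Real.exp_pos _).ne')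
        (inv_ne_zero one_ne_zero)), hord, one_smul]
    congr 2
    ring

end Image

theorem theorem3 (V : Set (P3 ℂ)) (hV : IsSubvariety V)
    (hVQ : ∀ W, IsIrredComponent V W → ¬ W ⊆ quadric) :
    (∀ p ∈ pointsKK V, ∃! x, IsMatrixValuation p x) ∧
    VAL '' pointsKK V = ConePoint.toP3 ''
      ({z | ∃ x : PSL2, x.1 ∈ V ∧ z = .vertex (sphericalCoamoeba x)} ∪
       {z | ∃ (α : Set.Ioi (0 : ℝ)) (s : circleBundle),
          complexClass s.1 ∈ V ∩ quadric ∧ z = .inner α s} ∪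
       {z | ∃ x : quadric, x.1 ∈ V ∧ z = .base x}) := by
  refine ⟨fun p _ => existsUnique_isMatrixValuation p, Set.Subset.antisymm ?_ ?_⟩
  · rintro _ ⟨p, hp, rfl⟩
    induction p using Projectivization.ind with
    | h A hA =>
    obtain ⟨α, B, h⟩ := exists_hasLeadingTerm hA
    have hBV := h.mk_mem_of_mem_pointsKK hV hp
    rw [h.VAL_eq]
    by_cases hd : B.det = 0
    · have hBQ : Projectivization.mk ℂ B h.1 ∈ quadric := mk_mem_quadric.2 hd
      by_cases hD : A.det = 0
      · refine ⟨.base ⟨_, hBQ⟩, Or.inr ⟨_, hBV, rfl⟩, ?_⟩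
        rw [hD, limitMatrix_zero, ← Complex.coe_smul,
          classOf_smul (Complex.ofReal_ne_zero.2 (Real.exp_pos α).ne'), classOf_eq_mk h.1]
        rfl
      · obtain ⟨u, hu, hud⟩ := exists_sq_mul_phase_eq_one (HahnSeries.leadingCoeff_ne_zero.2 hD)
        have hu0 : u ≠ 0 := by rintro rfl; simp at hu
        have hpos := (hd ▸ h.det).neg_order_lt hD
        have huB : u • B ≠ 0 := smul_ne_zero hu0 h.1
        have hs : Projectivization.mk ℝ (u • B) huB ∈ circleBundle :=
          ⟨_, huB, by rw [Matrix.det_smul, hd, mul_zero], rfl⟩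
        have hcl : complexClass (Projectivization.mk ℝ (u • B) huB) =
            Projectivization.mk ℂ B h.1 := by
          change Projectivization.mk ℂ (u • B) huB = _
          rw [Projectivization.mk_eq_mk_iff']
          exact ⟨u, rfl⟩
        have hα : 0 < α + A.det.order / 2 := by linarith
        refine ⟨.inner ⟨_, hα⟩ ⟨_, hs⟩, Or.inl (Or.inr ⟨_, _, ?_, rfl⟩), ?_⟩
        · rw [hcl]
          exact ⟨hBV, hBQ⟩
        · rw [inner_toP3, limitMatrix_eq_smul_coneMatrix α B _ hu hud, classOf_smul
            (mul_ne_zero (Complex.ofReal_ne_zero.2 (Real.exp_pos _).ne') (inv_ne_zero hu0))]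
    · have hBQ : Projectivization.mk ℂ B h.1 ∉ quadric := fun hq => hd (mk_mem_quadric.1 hq)
      refine ⟨.vertex (sphericalCoamoeba ⟨_, hBQ⟩), Or.inl (Or.inl ⟨⟨_, hBQ⟩, hBV, rfl⟩), ?_⟩
      rw [vertex_toP3 h.1 hd, h.classOf_limitMatrix_of_det_ne_zero hd]
  · rintro _ ⟨_, (⟨⟨x, hx⟩, hxV, rfl⟩ | ⟨α, ⟨_, B, hB, hd, rfl⟩, ⟨hBV, -⟩, rfl⟩) |
      ⟨⟨_, B, hB, hd, rfl⟩, hBV, rfl⟩, rfl⟩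
    · induction x using Projectivization.ind with
      | h B hB =>
      have hd : B.det ≠ 0 := fun h => hx (mk_mem_quadric.2 h)
      have h := hasLeadingTerm_map_C hB
      exact ⟨_, mk_map_C_mem_pointsKK hB hxV, by
        rw [vertex_toP3 hB hd, h.VAL_eq, h.classOf_limitMatrix_of_det_ne_zero hd]⟩
    · obtain ⟨p, hp, hval⟩ := exists_pointsKK_VAL_eq_coneMatrix hV hVQ hB hBV hd α.2
      exact ⟨p, hp, hval.trans (inner_toP3 α hB _).symm⟩
    · have h := hasLeadingTerm_map_C hB
      have hval : VAL (Projectivization.mk KK _ h.ne_zero) = classOf B := by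
        rw [h.VAL_eq, det_map_C, hd, map_zero, limitMatrix_zero, Real.exp_zero, one_smul]
      exact ⟨_, mk_map_C_mem_pointsKK hB hBV, hval.trans (classOf_eq_mk hB)⟩
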